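/- On $L^2(\mathbb R)$ let $(Q\psi)(q)=q\,\psi(q)$ and $(P\psi)(q)=-i\,\psi'(q)$ for Schwartz functions $\psi$, so that $[Q,P]=i$, and for $t\in\mathbb R$ let $Q(t)$ be the closure of $Q\cos t+P\sin t$ defined on the Schwartz functions. Each $Q(t)$ is self-adjoint, and the bounded operators $\operatorname{sgn}Q(t)$ and $E(t)=\theta(Q(t))$ are well defined (existence and uniqueness) by the Borel functional calculus, where $\theta(q)=1$ if $q>0$ and $\theta(q)=0$ otherwise. Put $$A=\operatorname{sgn}Q(0)+\operatorname{sgn}Q(2\pi/3)+\operatorname{sgn}Q(4\pi/3),\qquad M=\tfrac13\bigl(E(0)+E(2\pi/3)+E(4\pi/3)\bigr),$$ and for a unit vector $\psi\in L^2(\mathbb R)$ let $\operatorname{prob}(\psi)=\langle\psi|M|\psi\rangle$ be the probability that, in the state $\psi$, the coordinate of the harmonic oscillator is positive at a time chosen uniformly at random in $\{0,2\pi/3,4\pi/3\}$. Then: 1. $\|A\|<3$ (operator norm). 2. The probability is bounded away from $1$ over all states: there is $c<1$ with $\operatorname{prob}(\psi)\le c$ for all unit vectors $\psi$. 3. $M=\tfrac12+\tfrac16A$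 is self-adjoint; the least and the greatest points of its spectrum are $\tfrac12-\tfrac16\|A\|$ and $\tfrac12+\tfrac16\|A\|$, and these numbers are also the infimum and the supremum of $\operatorname{prob}(\psi)$ over all unit vectors $\psi$. -/

import Mathlib

open MeasureTheory
open scoped SchwartzMap InnerProductSpace ENNReal

noncomputable section

namespace Oscillator

/-! ### Functions of an unbounded self-adjoint operator -/

section FunctionalCalculus

variable {H : Type*} [NormedAddCommGroup H] [InnerProductSpace ℂ H]

/-- The unitary `U : H → L²(X, μ)` carries the unbounded operator `T` onto the (maximal)
operator of multiplication by the real measurable function `g`: a vector `ψ` belongs to the domain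
of `T` and `T ψ = η` if and only if `U η = g · U ψ` (so the domain of `T` consists of the `ψ` with
`g · U ψ ∈ L²(X, μ)`). -/
structure IsDiagonalization (T : H →ₗ.[ℂ] H) {X : Type} [MeasurableSpace X] (μ : Measure X)
    (U : H ≃ₗᵢ[ℂ] Lp ℂ 2 μ) (g : X → ℝ) : Prop where
  measurable : Measurable g
  mem_graph_iff : ∀ ψ η : H, (ψ, η) ∈ T.graph ↔ U η =ᵐ[μ] fun x => (g x : ℂ) * U ψ x

/-- The bounded operator `S` is the function `f` of the self-adjoint operator `T`, in the sense of
the Borel functional calculus: `T` is unitarily equivalent to multiplication by some real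
measurable `g`, and the same unitary carries `S` to multiplication by `f ∘ g`. -/
def IsFunctionOf (f : ℝ → ℝ) (T : H →ₗ.[ℂ] H) (S : H →L[ℂ] H) : Prop :=
  ∃ (X : Type) (_ : MeasurableSpace X) (μ : Measure X) (_ : SigmaFinite μ)
    (U : H ≃ₗᵢ[ℂ] Lp ℂ 2 μ) (g : X → ℝ),
    IsDiagonalization T μ U g ∧ ∀ ψ : H, U (S ψ) =ᵐ[μ] fun x => (f (g x) : ℂ) * U ψ x

open Classical in
/-- The bounded operator `f(T)`; the value is `0` if there is no such operator. -/
def functionOf (f : ℝ → ℝ) (T : H →ₗ.[ℂ] H) : H →L[ℂ] H :=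
  if h : ∃ S, IsFunctionOf f T S then h.choose else 0

end FunctionalCalculus

/-! ### The Schrödinger representation on `L²(ℝ)` -/

/-- The state space `L²(ℝ)`. -/
abbrev StateSpace : Type := Lp ℂ 2 (volume : Measure ℝ)

/-- The coordinate operator `(Q φ)(q) = q φ(q)` on Schwartz functions. -/
def positionS : 𝓢(ℝ, ℂ) →L[ℂ] 𝓢(ℝ, ℂ) :=
  SchwartzMap.smulLeftCLM ℂ (fun x : ℝ => (x : ℂ))

/-- The momentum operator `(P φ)(q) = -i φ'(q)` on Schwartz functions. -/
def momentumS : 𝓢(ℝ, ℂ) →L[ℂ] 𝓢(ℝ, ℂ) :=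
  (-Complex.I) • SchwartzMap.derivCLM ℂ ℂ

theorem positionS_apply (φ : 𝓢(ℝ, ℂ)) (x : ℝ) : positionS φ x = (x : ℂ) * φ x := by
  have h : Function.HasTemperateGrowth (fun x : ℝ => (x : ℂ)) :=
    Complex.ofRealCLM.hasTemperateGrowth
  simp [positionS, SchwartzMap.smulLeftCLM_apply_apply h]

theorem momentumS_apply (φ : 𝓢(ℝ, ℂ)) (x : ℝ) :
    momentumS φ x = -Complex.I * deriv φ x := by
  simp [momentumS]

/-- The canonical commutation relation `[Q, P] = i`. -/
theorem commutator (φ : 𝓢(ℝ, ℂ)) :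
    positionS (momentumS φ) - momentumS (positionS φ) = Complex.I • φ := by
  ext x
  have h : (positionS φ : ℝ → ℂ) = fun y : ℝ => (y : ℂ) * φ y :=
    funext (positionS_apply φ)
  have h1 : HasDerivAt (fun y : ℝ => (y : ℂ)) 1 x := (hasDerivAt_id x).ofReal_comp
  have h2 : HasDerivAt (φ : ℝ → ℂ) (deriv φ x) x := φ.differentiableAt.hasDerivAt
  have hd : deriv (positionS φ : ℝ → ℂ) x = 1 * φ x + (x : ℂ) * deriv φ x := by
    rw [h]
    exact (h1.mul h2).deriv
  rw [sub_apply, positionS_apply, momentumS_apply, momentumS_apply, hd,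
    smul_apply, smul_eq_mul]
  ring

/-- The embedding of the Schwartz space into `L²(ℝ)`. -/
def schwartzIncl : 𝓢(ℝ, ℂ) →ₗ[ℂ] StateSpace :=
  (SchwartzMap.toLpCLM ℂ ℂ 2 (volume : Measure ℝ)).toLinearMap

theorem schwartzIncl_injective : Function.Injective schwartzIncl :=
  SchwartzMap.injective_toLp 2 (volume : Measure ℝ)

/-- An operator on Schwartz functions, as an operator in `L²(ℝ)` with domain the Schwartz space. -/
def ofSchwartz (T : 𝓢(ℝ, ℂ) →L[ℂ] 𝓢(ℝ, ℂ)) : StateSpace →ₗ.[ℂ] StateSpace where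
  domain := LinearMap.range schwartzIncl
  toFun := schwartzIncl ∘ₗ T.toLinearMap ∘ₗ
    (LinearEquiv.ofInjective schwartzIncl schwartzIncl_injective).symm.toLinearMap

/-- The coordinate at time `t`: the self-adjoint operator `Q(t) = Q cos t + P sin t`, namely the
closure in `L²(ℝ)` of this expression on Schwartz functions. -/
def coordinate (t : ℝ) : StateSpace →ₗ.[ℂ] StateSpace :=
  (ofSchwartz ((Real.cos t : ℂ) • positionS + (Real.sin t : ℂ) • momentumS)).closure

/-- `θ(q) = 1` if `q > 0`, otherwise `0`. -/
def theta (q : ℝ) : ℝ := if 0 < q then 1 else 0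

/-- `sgn Q(t)`. -/
def sgnQ (t : ℝ) : StateSpace →L[ℂ] StateSpace := functionOf Real.sign (coordinate t)

/-- `E(t) = θ(Q(t))`, the projection that corresponds to the event that the coordinate is
positive at time `t`. -/
def projPos (t : ℝ) : StateSpace →L[ℂ] StateSpace := functionOf theta (coordinate t)

/-- `A = sgn Q(0) + sgn Q(2π/3) + sgn Q(4π/3)`. -/
def opA : StateSpace →L[ℂ] StateSpace :=
  sgnQ 0 + sgnQ (2 * Real.pi / 3) + sgnQ (4 * Real.pi / 3)

/-- `(E(0) + E(2π/3) + E(4π/3)) / 3`. -/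
def opE : StateSpace →L[ℂ] StateSpace :=
  (1 / 3 : ℂ) • (projPos 0 + projPos (2 * Real.pi / 3) + projPos (4 * Real.pi / 3))

/-- The probability, in the state `ψ`, that the coordinate is positive at a time chosen at random
among three equiprobable instants `0, 2π/3, 4π/3`:
`prob(ψ) = ⟨ψ | E(0) + E(2π/3) + E(4π/3) | ψ⟩ / 3`. -/
def prob (ψ : StateSpace) : ℝ := (⟪ψ, opE ψ⟫_ℂ).re

end Oscillator

end

noncomputable section

namespace Oscillator

open Filter Topology ComplexConjugate FourierTransform

/-! ### Multiplication operators on `L²`. -/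

section Multiplication

variable {X : Type*} [MeasurableSpace X] {μ : Measure X}

/-! For a unit vector, `prob ψ = 1 - deficit ψ / 3`, where `deficit ψ` is the sum of the `‖ψ - E(t)
ψ‖²`. The theorem therefore rests on a positive lower bound for the deficit on the unit sphere
(`exists_deficit_gap`).

The bound comes from phase space. For a fixed unit vector `φ`, the function `(q, b) ↦ ⟪reflection q
b φ, ψ⟫` is, up to scaling, a cross-Wigner function. Its squared modulus has total mass `‖φ‖² ‖ψ‖²`
(Moyal), and its marginal along each direction used is the convolution of the densities of `φ` and
`ψ` in the matching coordinate. Hence the mass in a half-plane where that coordinate is below `-R`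
is at most a tail of `φ` plus `‖ψ - E(t) ψ‖²`. The three coordinates sum to zero, so the three
half-planes cover everything outside a bounded set. There the reflected vectors `reflection q b φ`
form a compact family, controlled up to a small error by finitely many functionals of `ψ`. This
gives `coercivity`: the deficit dominates the norm modulo finitely many functionals.

Consequently, unit vectors with deficit tending to zero have a convergent subsequence, with a unit
limit fixed by all three projections. No such vector exists: after a chirp, the vector and its
Fourier transform would both live on a half-line (`eq_zero_of_halfLine_support`).

Finally, parity anticommutes with `A`, so the numerical range of `A` is symmetric and `‖A‖` is the
supremum of `⟪ψ, A ψ⟫`. The gap then gives `‖A‖ < 3`; both `±‖A‖` lie in the spectrum, and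
everything about `M` follows by an affine map. -/

theorem norm_sq_eq_integral (f : Lp ℂ 2 μ) : ‖f‖ ^ 2 = ∫ x, ‖f x‖ ^ 2 ∂μ := by
  have h := @inner_self_eq_norm_sq ℂ (Lp ℂ 2 μ) _ _ _ f
  rw [L2.inner_def] at h
  have : ∀ x, ⟪f x, f x⟫_ℂ = ((‖f x‖ ^ 2 : ℝ) : ℂ) := fun x => by
    rw [inner_self_eq_norm_sq_to_K]; norm_cast
  simp_rw [this] at h
  rw [integral_complex_ofReal] at h
  simpa using h.symm

theorem enorm_sq_eq_lintegral (f : Lp ℂ 2 μ) : ‖f‖ₑ ^ 2 = ∫⁻ x, ‖f x‖ₑ ^ 2 ∂μ := by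
  rw [Lp.enorm_def, eLpNorm_eq_lintegral_rpow_enorm_toReal (by simp) (by simp)]
  rw [← ENNReal.rpow_natCast, ← ENNReal.rpow_mul]
  simp

/-- Multiplication by an essentially bounded function. -/
def mulOp (m : X → ℂ) (hm : MemLp m ∞ μ) : Lp ℂ 2 μ →L[ℂ] Lp ℂ 2 μ :=
  (ContinuousLinearMap.mul ℂ ℂ).holderL μ ∞ 2 2 (hm.toLp m)

theorem coeFn_mulOp (m : X → ℂ) (hm : MemLp m ∞ μ) (f : Lp ℂ 2 μ) :
    mulOp m hm f =ᵐ[μ] fun x => m x * f x := by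
  have h := (ContinuousLinearMap.mul ℂ ℂ).coeFn_holder (r := 2) (hm.toLp m) f
  filter_upwards [h, hm.coeFn_toLp] with x h1 h2
  rw [← h2]
  exact h1

/-- Dominated convergence with majorant `(2C)² ‖f‖²`: bounded pointwise convergence of multipliers
is strong convergence of the operators. -/
theorem tendsto_of_mul {ι : Type*} {l : Filter ι} [l.IsCountablyGenerated] {f G : Lp ℂ 2 μ}
    {F : ι → Lp ℂ 2 μ} {m : ι → X → ℂ} {m₀ : X → ℂ} (C : ℝ)
    (hF : ∀ i, F i =ᵐ[μ] fun x => m i x * f x) (hG : G =ᵐ[μ] fun x => m₀ x * f x)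
    (hm : ∀ i x, ‖m i x‖ ≤ C) (hlim : ∀ x, Tendsto (fun i => m i x) l (𝓝 (m₀ x))) :
    Tendsto F l (𝓝 G) := by
  rcases l.eq_or_neBot with rfl | hl
  · exact tendsto_bot
  have hm₀ : ∀ x, ‖m₀ x‖ ≤ C := fun x =>
    le_of_tendsto (hlim x).norm (Eventually.of_forall fun i => hm i x)
  have hd : ∀ i, (fun x => ‖(F i - G : Lp ℂ 2 μ) x‖ ^ 2) =ᵐ[μ]
      fun x => ‖(m i x - m₀ x) * f x‖ ^ 2 := fun i => by
    filter_upwards [hF i, hG, Lp.coeFn_sub (F i) G] with x h1 h2 h3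
    rw [h3, Pi.sub_apply, h1, h2, sub_mul]
  rw [tendsto_iff_norm_sub_tendsto_zero]
  have key : Tendsto (fun i => ∫ x, ‖(m i x - m₀ x) * f x‖ ^ 2 ∂μ) l (𝓝 (∫ _, (0 : ℝ) ∂μ)) := by
    refine tendsto_integral_filter_of_dominated_convergence
      (fun x => (2 * C) ^ 2 * ‖f x‖ ^ 2) ?_ ?_ ?_ ?_
    · exact Eventually.of_forall fun i =>
        ((Lp.aestronglyMeasurable (F i - G)).norm.pow 2).congr (hd i)
    · refine Eventually.of_forall fun i => Eventually.of_forall fun x => ?_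
      rw [norm_pow, norm_norm, norm_mul, mul_pow]
      gcongr
      calc ‖m i x - m₀ x‖ ≤ ‖m i x‖ + ‖m₀ x‖ := norm_sub_le _ _
        _ ≤ 2 * C := by linarith [hm i x, hm₀ x]
    · exact ((Lp.memLp f).integrable_norm_pow (by simp)).const_mul _
    · refine Eventually.of_forall fun x => ?_
      have := ((((hlim x).sub_const (m₀ x)).mul_const (f x)).norm).pow 2
      simpa using this
  simp_rw [← fun i => integral_congr_ae (hd i)] at key
  simp_rw [← norm_sq_eq_integral] at key
  rw [integral_zero] at key
  have := (Real.continuous_sqrt.tendsto 0).comp key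
  simpa [Function.comp_def] using this

end Multiplication

/-! ### Borel functional calculus for the sign and for `theta`. -/

section Uniqueness

variable {H : Type*} [NormedAddCommGroup H] [InnerProductSpace ℂ H]
  {X : Type*} [MeasurableSpace X] {μ : Measure X}

/-- The unitary `U` carries the bounded operator `S` to multiplication by the function `m`. -/
def Diagonalizes (U : H ≃ₗᵢ[ℂ] Lp ℂ 2 μ) (m : X → ℝ) (S : H →L[ℂ] H) : Prop :=
  ∀ ψ : H, U (S ψ) =ᵐ[μ] fun x => (m x : ℂ) * U ψ x

namespace Diagonalizes

variable {U : H ≃ₗᵢ[ℂ] Lp ℂ 2 μ} {m m' : X → ℝ} {S S' : H →L[ℂ] H}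

theorem comp (h : Diagonalizes U m S) (h' : Diagonalizes U m' S') :
    Diagonalizes U (fun x => m x * m' x) (S * S') := fun ψ => by
  filter_upwards [h (S' ψ), h' ψ] with x h1 h2
  rw [mul_apply_eq_comp, h1, h2]
  push_cast
  ring

theorem add (h : Diagonalizes U m S) (h' : Diagonalizes U m' S') :
    Diagonalizes U (fun x => m x + m' x) (S + S') := fun ψ => by
  rw [add_apply, map_add]
  filter_upwards [h ψ, h' ψ, Lp.coeFn_add (U (S ψ)) (U (S' ψ))] with x h1 h2 h3
  rw [h3, Pi.add_apply, h1, h2]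
  push_cast
  ring

theorem smul (h : Diagonalizes U m S) (c : ℝ) :
    Diagonalizes U (fun x => c * m x) ((c : ℂ) • S) := fun ψ => by
  rw [smul_apply, map_smul]
  filter_upwards [h ψ, Lp.coeFn_smul (c : ℂ) (U (S ψ))] with x h1 h3
  rw [h3, Pi.smul_apply, h1, smul_eq_mul]
  push_cast
  ring

theorem one : Diagonalizes U (fun _ => 1) 1 := fun ψ => by
  filter_upwards with x
  simp

theorem congr (h : Diagonalizes U m S) (hm : m =ᵐ[μ] m') : Diagonalizes U m' S := fun ψ => by
  filter_upwards [h ψ, hm] with x h1 h2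
  rw [h1, h2]

theorem unique (h : Diagonalizes U m S) (h' : Diagonalizes U m S') : S = S' := by
  ext1 ψ
  apply U.injective
  apply Lp.ext
  exact (h ψ).trans (h' ψ).symm

theorem exists_of_bounded (U : H ≃ₗᵢ[ℂ] Lp ℂ 2 μ) (hm : Measurable m) (C : ℝ)
    (hC : ∀ x, |m x| ≤ C) : ∃ S : H →L[ℂ] H, Diagonalizes U m S := by
  have hm' : MemLp (fun x => (m x : ℂ)) ∞ μ :=
    memLp_top_of_bound (Complex.measurable_ofReal.comp hm).aestronglyMeasurable C
      (Eventually.of_forall fun x => by simpa using hC x)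
  refine ⟨U.symm.toContinuousLinearEquiv.toContinuousLinearMap ∘L mulOp _ hm' ∘L
    U.toContinuousLinearEquiv.toContinuousLinearMap, fun ψ => ?_⟩
  filter_upwards [coeFn_mulOp _ hm' (U ψ)] with x hx
  simpa using hx

end Diagonalizes

/-- Bounded odd functions, polynomials in `x / (1 + x²)`, that converge pointwise to the sign. -/
def signApprox : ℕ → ℝ → ℝ
  | 0, x => x / (1 + x ^ 2)
  | n + 1, x =>
    3 / 2 * signApprox n x + -1 / 2 * (signApprox n x * (signApprox n x * signApprox n x))

theorem signApprox_neg (n : ℕ) (x : ℝ) : signApprox n (-x) = -signApprox n x := by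
  induction n with
  | zero => simp [signApprox, neg_div]
  | succ n ih => simp only [signApprox, ih]; ring

theorem signApprox_zero_right (n : ℕ) : signApprox n 0 = 0 := by
  have := signApprox_neg n 0
  rw [neg_zero] at this
  linarith

theorem signApprox_zero_pos {x : ℝ} (hx : 0 < x) : 0 < signApprox 0 x ∧ signApprox 0 x ≤ 1 := by
  simp only [signApprox]
  refine ⟨by positivity, ?_⟩
  rw [div_le_one (by positivity)]
  nlinarith [sq_nonneg (x - 1)]

/-- The step `y ↦ (3y - y³)/2` satisfies `1 - y' = (1 - y)(1 - (y + y²)/2)`. On `(0, 1]` the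
iterates increase, so the contraction factor never exceeds its initial bound `1 - y₀/2`. -/
theorem signApprox_bounds {x : ℝ} (hx : 0 < x) (n : ℕ) :
    signApprox 0 x ≤ signApprox n x ∧ signApprox n x ≤ 1 ∧
      1 - signApprox n x ≤ (1 - signApprox 0 x / 2) ^ n := by
  obtain ⟨h0, h1⟩ := signApprox_zero_pos hx
  induction n with
  | zero => exact ⟨le_rfl, h1, by rw [pow_zero]; linarith⟩
  | succ n ih =>
    obtain ⟨a, b, c⟩ := ih
    have e : signApprox (n + 1) x = 3 / 2 * signApprox n x +
        -1 / 2 * (signApprox n x * (signApprox n x * signApprox n x)) := rfl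
    set y := signApprox n x
    set y0 := signApprox 0 x
    have hy : 0 < y := h0.trans_le a
    have e1 : 1 - signApprox (n + 1) x = (1 - y) * (1 - (y + y ^ 2) / 2) := by rw [e]; ring
    have hf0 : 0 ≤ 1 - (y + y ^ 2) / 2 := by nlinarith
    have hf1 : 1 - (y + y ^ 2) / 2 ≤ 1 - y0 / 2 := by nlinarith
    refine ⟨?_, ?_, ?_⟩
    · have : signApprox (n + 1) x - y = y * ((1 - y) * (1 + y)) / 2 := by rw [e]; ring
      have h2 : 0 ≤ y * ((1 - y) * (1 + y)) / 2 := by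
        have := sub_nonneg.2 b
        positivity
      linarith
    · have := mul_nonneg (sub_nonneg.2 b) hf0
      linarith
    · rw [e1, pow_succ]
      exact mul_le_mul c hf1 hf0 (le_trans (sub_nonneg.2 b) c)

theorem abs_signApprox_le (n : ℕ) (x : ℝ) : |signApprox n x| ≤ 1 := by
  have pos : ∀ {x : ℝ}, 0 < x → |signApprox n x| ≤ 1 := fun {x} hx => by
    obtain ⟨a, b, -⟩ := signApprox_bounds hx n
    rw [abs_of_pos ((signApprox_zero_pos hx).1.trans_le a)]
    exact b
  rcases lt_trichotomy x 0 with hx | rfl | hx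
  · have := pos (neg_pos.2 hx)
    rwa [signApprox_neg, abs_neg] at this
  · simp [signApprox_zero_right]
  · exact pos hx

theorem tendsto_signApprox (x : ℝ) :
    Tendsto (fun n => signApprox n x) atTop (𝓝 (Real.sign x)) := by
  have pos : ∀ {x : ℝ}, 0 < x → Tendsto (fun n => signApprox n x) atTop (𝓝 1) := fun {x} hx => by
    obtain ⟨h0, h1⟩ := signApprox_zero_pos hx
    have hp : Tendsto (fun n => 1 - (1 - signApprox 0 x / 2) ^ n) atTop (𝓝 (1 - 0)) :=
      tendsto_const_nhds.sub (tendsto_pow_atTop_nhds_zero_of_lt_one (by linarith) (by linarith))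
    rw [sub_zero] at hp
    refine tendsto_of_tendsto_of_tendsto_of_le_of_le hp tendsto_const_nhds (fun n => ?_) fun n => ?_
    · have := (signApprox_bounds hx n).2.2
      simp only
      linarith
    · exact (signApprox_bounds hx n).2.1
  rcases lt_trichotomy x 0 with hx | rfl | hx
  · have := (pos (neg_pos.2 hx)).neg
    simpa [signApprox_neg, Real.sign_of_neg hx] using this
  · simp [signApprox_zero_right]
  · simpa [Real.sign_of_pos hx] using pos hx

theorem sign_bound (x : ℝ) : |Real.sign x| ≤ 1 := by
  rcases Real.sign_apply_eq x with h | h | h <;> simp [h]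

theorem measurable_sign : Measurable Real.sign := by
  unfold Real.sign
  exact Measurable.ite measurableSet_Iio measurable_const
    (Measurable.ite measurableSet_Ioi measurable_const measurable_const)

/-- As a polynomial in the sign, correct also at `0`, `theta` inherits uniqueness from the sign. -/
theorem theta_eq (x : ℝ) : theta x = 1 / 2 * Real.sign x + 1 / 2 * (Real.sign x * Real.sign x) := by
  rcases lt_trichotomy x 0 with hx | rfl | hx
  · simp [theta, Real.sign_of_neg hx, hx.le]
  · simp [theta]
  · simp [theta, Real.sign_of_pos hx, hx]
    norm_num

theorem measurable_theta : Measurable theta :=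
  Measurable.ite measurableSet_Ioi measurable_const measurable_const

theorem theta_bound (x : ℝ) : |theta x| ≤ 1 := by
  unfold theta
  split_ifs <;> simp

section Two

variable {T : H →ₗ.[ℂ] H} {X : Type} [MeasurableSpace X] {μ : Measure X} {U : H ≃ₗᵢ[ℂ] Lp ℂ 2 μ}
  {g : X → ℝ} {X' : Type} [MeasurableSpace X'] {μ' : Measure X'} {U' : H ≃ₗᵢ[ℂ] Lp ℂ 2 μ'}
  {g' : X' → ℝ}

/-- With `K = (1 + T²)⁻¹` and `B = T (1 + T²)⁻¹`, the pairs `(K ψ, B ψ)` and `(B ψ, ψ - K ψ)` lie in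
the graph of `T`. These relations mention no diagonalization; read in the second one, they force `(1
+ g'²) U'(B ψ) = g' U' ψ`, so both diagonalizations yield the same `B`. -/
theorem IsDiagonalization.exists_signApprox_zero (h : IsDiagonalization T μ U g)
    (h' : IsDiagonalization T μ' U' g') :
    ∃ S, Diagonalizes U (fun x => signApprox 0 (g x)) S ∧
      Diagonalizes U' (fun x => signApprox 0 (g' x)) S := by
  have hmeas := h.measurable
  obtain ⟨B, hB⟩ := Diagonalizes.exists_of_bounded (m := fun x => signApprox 0 (g x)) U
    (by simp only [signApprox]; fun_prop) 1 fun x => abs_signApprox_le 0 _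
  obtain ⟨K, hK⟩ := Diagonalizes.exists_of_bounded (m := fun x => 1 / (1 + g x ^ 2)) U
    (by fun_prop) 1 fun x => by
      rw [abs_of_nonneg (by positivity), div_le_one (by positivity)]
      nlinarith [sq_nonneg (g x)]
  refine ⟨B, hB, fun ψ => ?_⟩
  have h1 : (K ψ, B ψ) ∈ T.graph := by
    rw [h.mem_graph_iff]
    filter_upwards [hB ψ, hK ψ] with x hx hx'
    rw [hx, hx', signApprox]
    push_cast
    ring
  have h2 : (B ψ, ψ - K ψ) ∈ T.graph := by
    rw [h.mem_graph_iff, map_sub]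
    filter_upwards [hB ψ, hK ψ, Lp.coeFn_sub (U ψ) (U (K ψ))] with x hx hx' hs
    have hne : (1 + (g x : ℂ) ^ 2) ≠ 0 := by
      exact_mod_cast (by positivity : (1 + g x ^ 2 : ℝ) ≠ 0)
    rw [hs, Pi.sub_apply, hx, hx', signApprox]
    push_cast
    field_simp
    ring
  rw [h'.mem_graph_iff] at h1 h2
  rw [map_sub] at h2
  filter_upwards [h1, h2, Lp.coeFn_sub (U' ψ) (U' (K ψ))] with x h1 h2 hs
  rw [hs, Pi.sub_apply, h1] at h2
  have hne : (1 + (g' x : ℂ) ^ 2) ≠ 0 := by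
    exact_mod_cast (by positivity : (1 + g' x ^ 2 : ℝ) ≠ 0)
  rw [h1, signApprox]
  push_cast
  rw [div_mul_eq_mul_div, eq_div_iff hne]
  linear_combination (-(g' x : ℂ)) * h2

theorem IsDiagonalization.exists_signApprox (h : IsDiagonalization T μ U g)
    (h' : IsDiagonalization T μ' U' g') (n : ℕ) :
    ∃ S, Diagonalizes U (fun x => signApprox n (g x)) S ∧
      Diagonalizes U' (fun x => signApprox n (g' x)) S := by
  induction n with
  | zero => exact h.exists_signApprox_zero h'
  | succ n ih =>
    obtain ⟨S, h1, h2⟩ := ih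
    exact ⟨_, (h1.smul (3 / 2)).add ((h1.comp (h1.comp h1)).smul (-1 / 2)),
      (h2.smul (3 / 2)).add ((h2.comp (h2.comp h2)).smul (-1 / 2))⟩

theorem Diagonalizes.tendsto_sign {S : H →L[ℂ] H} {Sn : ℕ → H →L[ℂ] H}
    (hS : Diagonalizes U (fun x => Real.sign (g x)) S)
    (hn : ∀ n, Diagonalizes U (fun x => signApprox n (g x)) (Sn n)) (ψ : H) :
    Tendsto (fun n => Sn n ψ) atTop (𝓝 (S ψ)) := by
  have := tendsto_of_mul (l := atTop) 1 (fun n => hn n ψ) (hS ψ)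
    (fun n x => by simpa using abs_signApprox_le n (g x)) fun x =>
      (Complex.continuous_ofReal.tendsto _).comp (tendsto_signApprox (g x))
  simpa [Function.comp_def] using (U.symm.continuous.tendsto _).comp this

/-- Both candidates are strong limits of the same polynomials in `T (1 + T²)⁻¹`, an operator that
does not depend on the diagonalization. -/
theorem IsDiagonalization.sign_unique (h : IsDiagonalization T μ U g)
    (h' : IsDiagonalization T μ' U' g') {S S' : H →L[ℂ] H}
    (hS : Diagonalizes U (fun x => Real.sign (g x)) S)
    (hS' : Diagonalizes U' (fun x => Real.sign (g' x)) S') : S = S' := by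
  choose Sn h1 h2 using h.exists_signApprox h'
  ext1 ψ
  exact tendsto_nhds_unique (hS.tendsto_sign h1 ψ) (hS'.tendsto_sign h2 ψ)

theorem IsDiagonalization.theta_unique (h : IsDiagonalization T μ U g)
    (h' : IsDiagonalization T μ' U' g') {S S' : H →L[ℂ] H}
    (hS : Diagonalizes U (fun x => theta (g x)) S)
    (hS' : Diagonalizes U' (fun x => theta (g' x)) S') : S = S' := by
  obtain ⟨R, hR⟩ := Diagonalizes.exists_of_bounded U (measurable_sign.comp h.measurable) 1
    fun x => sign_bound (g x)
  obtain ⟨R', hR'⟩ := Diagonalizes.exists_of_bounded U' (measurable_sign.comp h'.measurable) 1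
    fun x => sign_bound (g' x)
  obtain rfl := h.sign_unique h' hR hR'
  have e := (hR.smul (1 / 2)).add ((hR.comp hR).smul (1 / 2))
  have e' := (hR'.smul (1 / 2)).add ((hR'.comp hR').smul (1 / 2))
  simp only [theta_eq] at hS hS'
  exact (hS.unique e).trans (hS'.unique e').symm

theorem IsDiagonalization.existsUnique_sign [SigmaFinite μ] (h : IsDiagonalization T μ U g) :
    ∃! S, IsFunctionOf Real.sign T S := by
  obtain ⟨R, hR⟩ := Diagonalizes.exists_of_bounded U (measurable_sign.comp h.measurable) 1
    fun x => sign_bound (g x)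
  refine ⟨R, ⟨X, _, μ, inferInstance, U, g, h, hR⟩, ?_⟩
  rintro S ⟨X', _, μ', _, U', g', h', hS⟩
  exact h'.sign_unique h hS hR

theorem IsDiagonalization.existsUnique_theta [SigmaFinite μ] (h : IsDiagonalization T μ U g) :
    ∃! S, IsFunctionOf theta T S := by
  obtain ⟨R, hR⟩ := Diagonalizes.exists_of_bounded U (measurable_theta.comp h.measurable) 1
    fun x => theta_bound (g x)
  refine ⟨R, ⟨X, _, μ, inferInstance, U, g, h, hR⟩, ?_⟩
  rintro S ⟨X', _, μ', _, U', g', h', hS⟩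
  exact h'.theta_unique h hS hR

theorem IsDiagonalization.functionOf_sign [SigmaFinite μ] (h : IsDiagonalization T μ U g) :
    Diagonalizes U (fun x => Real.sign (g x)) (functionOf Real.sign T) := by
  obtain ⟨R, hR⟩ := Diagonalizes.exists_of_bounded U (measurable_sign.comp h.measurable) 1
    fun x => sign_bound (g x)
  have hex := h.existsUnique_sign.exists
  have : functionOf Real.sign T = R := by
    rw [functionOf, dif_pos hex]
    exact h.existsUnique_sign.unique hex.choose_spec ⟨X, _, μ, inferInstance, U, g, h, hR⟩
  rw [this]
  exact hR

theorem IsDiagonalization.functionOf_theta [SigmaFinite μ] (h : IsDiagonalization T μ U g) :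
    Diagonalizes U (fun x => theta (g x)) (functionOf theta T) := by
  obtain ⟨R, hR⟩ := Diagonalizes.exists_of_bounded U (measurable_theta.comp h.measurable) 1
    fun x => theta_bound (g x)
  have hex := h.existsUnique_theta.exists
  have : functionOf theta T = R := by
    rw [functionOf, dif_pos hex]
    exact h.existsUnique_theta.unique hex.choose_spec ⟨X, _, μ, inferInstance, U, g, h, hR⟩
  rw [this]
  exact hR

end Two

end Uniqueness

/-! ### Diagonalizable operators are self-adjoint. -/

section SelfAdjoint

variable {H : Type*} [NormedAddCommGroup H] [InnerProductSpace ℂ H]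

theorem Diagonalizes.inner_comm {X : Type*} [MeasurableSpace X] {μ : Measure X}
    {U : H ≃ₗᵢ[ℂ] Lp ℂ 2 μ} {m : X → ℝ} {S : H →L[ℂ] H}
    (h : Diagonalizes U m S) (φ ψ : H) : ⟪S φ, ψ⟫_ℂ = ⟪φ, S ψ⟫_ℂ := by
  rw [← U.inner_map_map, ← U.inner_map_map φ, L2.inner_def, L2.inner_def]
  apply integral_congr_ae
  filter_upwards [h φ, h ψ] with x h1 h2
  rw [h1, h2]
  simp
  ring

theorem Diagonalizes.isSelfAdjoint [CompleteSpace H] {X : Type*} [MeasurableSpace X]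
    {μ : Measure X} {U : H ≃ₗᵢ[ℂ] Lp ℂ 2 μ} {m : X → ℝ} {S : H →L[ℂ] H}
    (h : Diagonalizes U m S) : IsSelfAdjoint S := by
  rw [ContinuousLinearMap.isSelfAdjoint_iff_isSymmetric]
  exact h.inner_comm

variable {T : H →ₗ.[ℂ] H} {X : Type} [MeasurableSpace X] {μ : Measure X} {U : H ≃ₗᵢ[ℂ] Lp ℂ 2 μ}
  {g : X → ℝ}

/-- Supplies enough explicit elements of the graph to test both density of the domain and membership
in the adjoint. -/
theorem IsDiagonalization.exists_resolvent (h : IsDiagonalization T μ U g) :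
    ∃ K B : H →L[ℂ] H, Diagonalizes U (fun x => 1 / (1 + g x ^ 2)) K ∧
      Diagonalizes U (fun x => g x / (1 + g x ^ 2)) B ∧ ∀ χ, (K χ, B χ) ∈ T.graph := by
  have hmeas := h.measurable
  obtain ⟨B, hB⟩ := Diagonalizes.exists_of_bounded (m := fun x => g x / (1 + g x ^ 2)) U
    (by fun_prop) 1 fun x => abs_signApprox_le 0 _
  obtain ⟨K, hK⟩ := Diagonalizes.exists_of_bounded (m := fun x => 1 / (1 + g x ^ 2)) U
    (by fun_prop) 1 fun x => by
      rw [abs_of_nonneg (by positivity), div_le_one (by positivity)]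
      nlinarith [sq_nonneg (g x)]
  refine ⟨K, B, hK, hB, fun χ => ?_⟩
  rw [h.mem_graph_iff]
  filter_upwards [hB χ, hK χ] with x hx hx'
  rw [hx, hx']
  push_cast
  ring

theorem IsDiagonalization.dense_domain [CompleteSpace H] (h : IsDiagonalization T μ U g) :
    Dense (T.domain : Set H) := by
  obtain ⟨K, B, hK, -, hKB⟩ := h.exists_resolvent
  rw [Submodule.dense_iff_topologicalClosure_eq_top, Submodule.topologicalClosure_eq_top_iff,
    Submodule.eq_bot_iff]
  intro y hy
  rw [Submodule.mem_orthogonal] at hy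
  -- The vector `K (K y)` is in the domain, so `y` is orthogonal to it, and symmetry of `K` turns
  -- this into `‖K y‖² = 0`.
  have hKy : K y = 0 := by
    rw [← inner_self_eq_zero (𝕜 := ℂ), ← hK.inner_comm]
    have := hKB (K y)
    rw [LinearPMap.mem_graph_iff] at this
    obtain ⟨z, hz, -⟩ := this
    have := hy z z.2
    rwa [hz] at this
  have h1 := hK y
  rw [hKy, map_zero] at h1
  rw [← U.map_eq_zero_iff]
  apply Lp.ext
  filter_upwards [h1, Lp.coeFn_zero ℂ 2 μ] with x hx hx'
  rw [hx', Pi.zero_apply, eq_comm, mul_eq_zero] at hx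
  rw [hx', Pi.zero_apply]
  refine hx.resolve_left ?_
  exact_mod_cast (by positivity : (1 / (1 + g x ^ 2) : ℝ) ≠ 0)

theorem IsDiagonalization.isSelfAdjoint [CompleteSpace H] (h : IsDiagonalization T μ U g) :
    IsSelfAdjoint T := by
  rw [LinearPMap.isSelfAdjoint_def]
  apply LinearPMap.eq_of_eq_graph
  rw [LinearPMap.adjoint_graph_eq_graph_adjoint h.dense_domain]
  ext ⟨ψ, η⟩
  rw [Submodule.mem_adjoint_iff]
  constructor
  · intro hψ
    obtain ⟨K, B, hK, hB, hKB⟩ := h.exists_resolvent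
    -- Testing the adjoint relation on `(K χ, B χ)` for all `χ`; clearing the factor `1 / (1 + g²)`
    -- then gives `U η = g · U ψ`.
    have e : B ψ = K η := by
      refine ext_inner_left ℂ fun χ => ?_
      rw [← hB.inner_comm, ← hK.inner_comm, ← sub_eq_zero]
      exact hψ _ _ (hKB χ)
    rw [h.mem_graph_iff]
    filter_upwards [hB ψ, hK η] with x h1 h2
    rw [e, h2] at h1
    have hne : (1 + (g x : ℂ) ^ 2) ≠ 0 := by
      exact_mod_cast (by positivity : (1 + g x ^ 2 : ℝ) ≠ 0)
    push_cast at h1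
    field_simp at h1
    exact h1
  · intro hψ a b hab
    rw [h.mem_graph_iff] at hψ hab
    rw [sub_eq_zero, ← U.inner_map_map, ← U.inner_map_map a, L2.inner_def, L2.inner_def]
    apply integral_congr_ae
    filter_upwards [hψ, hab] with x h1 h2
    rw [h1, h2]
    simp
    ring

end SelfAdjoint

/-! ### The Fourier character. -/

section Phase

/-- The character `x ↦ exp (2πix)`. -/
def phase (x : ℝ) : ℂ := (Real.fourierChar x : ℂ)

theorem phase_eq (x : ℝ) : phase x = Complex.exp ((2 * Real.pi * Complex.I) * x) := by
  rw [phase, Real.fourierChar_apply]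
  push_cast
  ring_nf

theorem norm_phase (x : ℝ) : ‖phase x‖ = 1 := Circle.norm_coe _

theorem phase_add (x y : ℝ) : phase (x + y) = phase x * phase y := by
  simp [phase, AddChar.map_add_eq_mul]

theorem phase_zero : phase 0 = 1 := by simp [phase_eq]

theorem phase_neg (x : ℝ) : phase (-x) = conj (phase x) := by
  rw [phase, AddChar.map_neg_eq_inv, Circle.coe_inv_eq_conj, phase]

theorem continuous_phase : Continuous phase :=
  continuous_subtype_val.comp Real.continuous_fourierChar

theorem hasDerivAt_phase (x : ℝ) : HasDerivAt phase (2 * Real.pi * Complex.I * phase x) x := by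
  have h : HasDerivAt (fun y : ℝ => Complex.exp ((2 * Real.pi * Complex.I) * y))
      (Complex.exp ((2 * Real.pi * Complex.I) * x) * ((2 * Real.pi * Complex.I) * 1)) x :=
    (((hasDerivAt_id x).ofReal_comp).const_mul _).cexp
  rw [funext phase_eq]
  convert h using 1
  ring

theorem fourier_eq_phase (f : ℝ → ℂ) (w : ℝ) : 𝓕 f w = ∫ v, phase (-(v * w)) * f v := by
  rw [Real.fourier_real_eq]
  rfl

theorem hasTemperateGrowth_phase : phase.HasTemperateGrowth := by
  have hd : ∀ n : ℕ, iteratedDeriv n phase = fun x => (2 * Real.pi * Complex.I) ^ n * phase x := by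
    intro n
    induction n with
    | zero => simp
    | succ n ih =>
      rw [iteratedDeriv_succ, ih]
      ext x
      rw [((hasDerivAt_phase x).const_mul _).deriv]
      ring
  constructor
  · rw [funext phase_eq]
    exact (contDiff_const.mul Complex.ofRealCLM.contDiff).cexp
  · intro n
    refine ⟨0, ‖(2 * Real.pi * Complex.I) ^ n‖, fun x => ?_⟩
    rw [norm_iteratedFDeriv_eq_norm_iteratedDeriv, hd, norm_mul, norm_phase]
    simp

end Phase

/-! ### Chirps, phase-plane reflections and the Fourier transform. -/

section Unitaries

variable {X : Type*} [MeasurableSpace X] {μ : Measure X}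

theorem mulOp_mulOp_of_mul_eq_one {m m' : X → ℂ} (hm : MemLp m ∞ μ) (hm' : MemLp m' ∞ μ)
    (h : ∀ x, m x * m' x = 1) (f : Lp ℂ 2 μ) : mulOp m hm (mulOp m' hm' f) = f := by
  apply Lp.ext
  filter_upwards [coeFn_mulOp m hm (mulOp m' hm' f), coeFn_mulOp m' hm' f] with x h2 h3
  rw [h2, h3, ← mul_assoc, h, one_mul]

theorem memLp_top_of_norm_eq_one {m : X → ℂ} (hm : Measurable m) (h1 : ∀ x, ‖m x‖ = 1) :
    MemLp m ∞ μ :=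
  memLp_top_of_bound hm.aestronglyMeasurable 1 (Eventually.of_forall fun x => (h1 x).le)

/-- Multiplication by a unimodular function. -/
def mulUnitary (m : X → ℂ) (hm : Measurable m) (h1 : ∀ x, ‖m x‖ = 1) :
    Lp ℂ 2 μ ≃ₗᵢ[ℂ] Lp ℂ 2 μ where
  toFun := mulOp m (memLp_top_of_norm_eq_one hm h1)
  map_add' := map_add _
  map_smul' := map_smul _
  invFun := mulOp (fun x => conj (m x)) (memLp_top_of_norm_eq_one
    (Complex.continuous_conj.measurable.comp hm) fun x => by simp [h1 x])
  left_inv := mulOp_mulOp_of_mul_eq_one _ _ fun x => by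
    rw [← Complex.normSq_eq_conj_mul_self, Complex.normSq_eq_norm_sq, h1]; simp
  right_inv := mulOp_mulOp_of_mul_eq_one _ _ fun x => by
    rw [mul_comm, ← Complex.normSq_eq_conj_mul_self, Complex.normSq_eq_norm_sq, h1]; simp
  norm_map' f := by
    rw [← sq_eq_sq₀ (norm_nonneg _) (norm_nonneg _), norm_sq_eq_integral, norm_sq_eq_integral]
    apply integral_congr_ae
    filter_upwards [coeFn_mulOp m (memLp_top_of_norm_eq_one hm h1) f] with x hx
    change ‖mulOp m (memLp_top_of_norm_eq_one hm h1) f x‖ ^ 2 = _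
    rw [hx, norm_mul, h1, one_mul]

theorem coeFn_mulUnitary (m : X → ℂ) (hm : Measurable m) (h1 : ∀ x, ‖m x‖ = 1) (f : Lp ℂ 2 μ) :
    mulUnitary m hm h1 f =ᵐ[μ] fun x => m x * f x :=
  coeFn_mulOp m (memLp_top_of_norm_eq_one hm h1) f

/-- Multiplication by the chirp `exp (iπcx²)`. -/
def chirp (c : ℝ) : StateSpace ≃ₗᵢ[ℂ] StateSpace :=
  mulUnitary (fun x : ℝ => phase (c / 2 * x ^ 2))
    (continuous_phase.comp (by fun_prop)).measurable fun _ => norm_phase _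

theorem coeFn_chirp (c : ℝ) (f : StateSpace) :
    chirp c f =ᵐ[volume] fun x => phase (c / 2 * x ^ 2) * f x := coeFn_mulUnitary _ _ _ f

/-- The reflection `f ↦ exp (2πibx) f (a - x)` in the phase plane. -/
def reflection (a b : ℝ) : StateSpace →ₗᵢ[ℂ] StateSpace :=
  (mulUnitary (fun x : ℝ => phase (b * x))
    (continuous_phase.comp (by fun_prop)).measurable fun _ => norm_phase _).toLinearIsometry.comp
    (Lp.compMeasurePreservingₗᵢ ℂ (fun x : ℝ => a - x)
      (Measure.measurePreserving_sub_left volume a))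

theorem coeFn_reflection (a b : ℝ) (f : StateSpace) :
    reflection a b f =ᵐ[volume] fun x => phase (b * x) * f (a - x) := by
  have hp := Measure.measurePreserving_sub_left (volume : Measure ℝ) a
  have h := coeFn_mulUnitary (fun x : ℝ => phase (b * x))
    (continuous_phase.comp (by fun_prop)).measurable (fun _ => norm_phase _)
    (Lp.compMeasurePreserving (fun x : ℝ => a - x) hp f)
  filter_upwards [h, Lp.coeFn_compMeasurePreserving f hp] with x h1 h2
  rw [h2] at h1
  exact h1

/-- The chirp on Schwartz functions. -/
def chirpS (c : ℝ) : 𝓢(ℝ, ℂ) →L[ℂ] 𝓢(ℝ, ℂ) :=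
  SchwartzMap.smulLeftCLM ℂ fun x : ℝ => phase (c / 2 * x ^ 2)

theorem chirpS_apply (c : ℝ) (φ : 𝓢(ℝ, ℂ)) (x : ℝ) :
    chirpS c φ x = phase (c / 2 * x ^ 2) * φ x := by
  have h : (fun x : ℝ => phase (c / 2 * x ^ 2)).HasTemperateGrowth :=
    hasTemperateGrowth_phase.comp (f := fun x : ℝ => c / 2 * x ^ 2) (by fun_prop)
  simp [chirpS, SchwartzMap.smulLeftCLM_apply_apply h]

/-- The reflection in the phase plane on Schwartz functions. -/
def reflectionS (a b : ℝ) : 𝓢(ℝ, ℂ) →L[ℂ] 𝓢(ℝ, ℂ) :=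
  SchwartzMap.smulLeftCLM ℂ (fun x : ℝ => phase (b * x)) ∘L SchwartzMap.compSubConstCLM ℂ a ∘L
    SchwartzMap.compCLMOfContinuousLinearEquiv ℂ (ContinuousLinearEquiv.neg ℝ)

theorem reflectionS_apply (a b : ℝ) (φ : 𝓢(ℝ, ℂ)) (x : ℝ) :
    reflectionS a b φ x = phase (b * x) * φ (a - x) := by
  have h : (fun x : ℝ => phase (b * x)).HasTemperateGrowth :=
    hasTemperateGrowth_phase.comp (f := fun x : ℝ => b * x) (by fun_prop)
  simp [reflectionS, SchwartzMap.smulLeftCLM_apply_apply h]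

theorem coeFn_schwartzIncl (φ : 𝓢(ℝ, ℂ)) : schwartzIncl φ =ᵐ[volume] φ :=
  φ.coeFn_toLp 2 volume

theorem denseRange_schwartzIncl : DenseRange schwartzIncl :=
  SchwartzMap.denseRange_toLpCLM ENNReal.ofNat_ne_top

theorem chirp_schwartzIncl (c : ℝ) (φ : 𝓢(ℝ, ℂ)) :
    chirp c (schwartzIncl φ) = schwartzIncl (chirpS c φ) := by
  apply Lp.ext
  filter_upwards [coeFn_chirp c (schwartzIncl φ), coeFn_schwartzIncl φ,
    coeFn_schwartzIncl (chirpS c φ)] with x h1 h2 h3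
  rw [h1, h2, h3, chirpS_apply]

theorem reflection_schwartzIncl (a b : ℝ) (φ : 𝓢(ℝ, ℂ)) :
    reflection a b (schwartzIncl φ) = schwartzIncl (reflectionS a b φ) := by
  apply Lp.ext
  filter_upwards [coeFn_reflection a b (schwartzIncl φ),
    (Measure.measurePreserving_sub_left volume a).quasiMeasurePreserving.ae (coeFn_schwartzIncl φ),
    coeFn_schwartzIncl (reflectionS a b φ)] with x h1 h2 h3
  rw [h1, h2, h3, reflectionS_apply]

/-- The Fourier transform on `L²(ℝ)`. -/
def fourierL2 : StateSpace ≃ₗᵢ[ℂ] StateSpace := Lp.fourierTransformₗᵢ ℝ ℂ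

theorem fourierL2_schwartzIncl (φ : 𝓢(ℝ, ℂ)) :
    fourierL2 (schwartzIncl φ) = schwartzIncl (𝓕 φ) :=
  φ.toLp_fourier_eq

/-- The Fourier transform rotates the phase plane by a quarter turn: `(a, b)` becomes `(b, -a)`, up
to a unimodular factor. The substitution is `v ↦ a - v`. -/
theorem fourier_reflectionS (a b : ℝ) (φ : 𝓢(ℝ, ℂ)) :
    𝓕 (reflectionS a b φ) = phase (a * b) • reflectionS b (-a) (𝓕 φ) := by
  ext w
  rw [smul_apply, reflectionS_apply, SchwartzMap.fourier_coe, fourier_eq_phase,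
    SchwartzMap.fourier_coe, fourier_eq_phase, smul_eq_mul, ← mul_assoc, ← integral_const_mul,
    ← integral_sub_left_eq_self _ volume a]
  apply integral_congr_ae
  filter_upwards with v
  simp only [reflectionS_apply, sub_sub_cancel]
  rw [← mul_assoc, ← mul_assoc, ← phase_add, ← phase_add, ← phase_add]
  congr 2
  ring

theorem ext_schwartz {A B : StateSpace → StateSpace} (hA : Continuous A) (hB : Continuous B)
    (h : ∀ φ, A (schwartzIncl φ) = B (schwartzIncl φ)) (f : StateSpace) : A f = B f :=
  congrFun (denseRange_schwartzIncl.equalizer hA hB (funext h)) f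

theorem fourierL2_reflection (a b : ℝ) (f : StateSpace) :
    fourierL2 (reflection a b f) = phase (a * b) • reflection b (-a) (fourierL2 f) := by
  refine ext_schwartz (A := fun f => fourierL2 (reflection a b f))
    (B := fun f => phase (a * b) • reflection b (-a) (fourierL2 f))
    (fourierL2.continuous.comp (reflection a b).continuous)
    ((continuous_const_smul _).comp ((reflection b (-a)).continuous.comp fourierL2.continuous))
    (fun φ => ?_) f
  simp only [reflection_schwartzIncl, fourierL2_schwartzIncl, fourier_reflectionS, map_smul]

/-- A chirp acts on the phase plane as the shear `(a, b) ↦ (a, b + c a)`, up to a unimodular factor.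
-/
theorem chirp_reflection (c a b : ℝ) (f : StateSpace) :
    chirp c (reflection a b f) =
      phase (-(c / 2 * a ^ 2)) • reflection a (b + c * a) (chirp c f) := by
  apply Lp.ext
  filter_upwards [coeFn_chirp c (reflection a b f), coeFn_reflection a b f,
    (Measure.measurePreserving_sub_left volume a).quasiMeasurePreserving.ae (coeFn_chirp c f),
    coeFn_reflection a (b + c * a) (chirp c f),
    Lp.coeFn_smul (phase (-(c / 2 * a ^ 2))) (reflection a (b + c * a) (chirp c f))]
    with x h1 h2 h3 h4 h5
  rw [h5, Pi.smul_apply, h4, h3, h1, h2, smul_eq_mul, ← mul_assoc, ← mul_assoc, ← mul_assoc,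
    ← phase_add, ← phase_add, ← phase_add]
  congr 2
  ring

end Unitaries

/-! ### The closure of a multiplication operator from Schwartz functions is maximal. -/

section Core

theorem ofSchwartz_graph (T : 𝓢(ℝ, ℂ) →L[ℂ] 𝓢(ℝ, ℂ)) (p : StateSpace × StateSpace) :
    p ∈ (ofSchwartz T).graph ↔ ∃ φ, schwartzIncl φ = p.1 ∧ schwartzIncl (T φ) = p.2 := by
  rw [LinearPMap.mem_graph_iff]
  have key : ∀ φ, ofSchwartz T ⟨schwartzIncl φ, φ, rfl⟩ = schwartzIncl (T φ) := fun φ => by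
    change schwartzIncl (T ((LinearEquiv.ofInjective schwartzIncl schwartzIncl_injective).symm
      ⟨schwartzIncl φ, φ, rfl⟩)) = _
    congr 2
    rw [LinearEquiv.symm_apply_eq]
    rfl
  constructor
  · rintro ⟨⟨_, φ, rfl⟩, h1, h2⟩
    exact ⟨φ, h1, by rw [← h2]; exact (key φ).symm⟩
  · rintro ⟨φ, h1, h2⟩
    exact ⟨⟨schwartzIncl φ, φ, rfl⟩, h1, (key φ).trans h2⟩

theorem one_add_I_mul_ne_zero (y : ℝ) : (1 + Complex.I * y : ℂ) ≠ 0 := by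
  intro h
  have := congrArg Complex.re h
  simp at this

theorem one_le_norm_one_add_I_mul (y : ℝ) : 1 ≤ ‖(1 + Complex.I * y : ℂ)‖ := by
  have := Complex.abs_re_le_norm (1 + Complex.I * y : ℂ)
  simpa using this

theorem norm_le_norm_one_add_I_mul (y : ℝ) : ‖(y : ℂ)‖ ≤ ‖(1 + Complex.I * y : ℂ)‖ := by
  have := Complex.abs_im_le_norm (1 + Complex.I * y : ℂ)
  simpa using this

theorem memLp_resolvent (κ : ℝ) :
    MemLp (fun x : ℝ => (1 + Complex.I * ↑(κ * x) : ℂ)⁻¹) ∞ (volume : Measure ℝ) := by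
  refine memLp_top_of_bound (Measurable.aestronglyMeasurable (by fun_prop)) 1
    (Eventually.of_forall fun x => ?_)
  rw [norm_inv]
  exact inv_le_one_of_one_le₀ (one_le_norm_one_add_I_mul _)

theorem memLp_mul_resolvent (κ : ℝ) :
    MemLp (fun x : ℝ => (↑(κ * x) * (1 + Complex.I * ↑(κ * x))⁻¹ : ℂ)) ∞ (volume : Measure ℝ) := by
  refine memLp_top_of_bound (Measurable.aestronglyMeasurable (by fun_prop)) 1
    (Eventually.of_forall fun x => ?_)
  rw [norm_mul, norm_inv, ← div_eq_mul_inv]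
  exact div_le_one_of_le₀ (norm_le_norm_one_add_I_mul _) (norm_nonneg _)

theorem hasTemperateGrowth_resolvent (κ : ℝ) :
    (fun x : ℝ => (1 + Complex.I * ↑(κ * x) : ℂ)⁻¹).HasTemperateGrowth := by
  have h1 : (fun x : ℝ => (1 + ‖x‖ ^ 2) ^ (-1 : ℝ)).HasTemperateGrowth :=
    Function.hasTemperateGrowth_one_add_norm_sq_rpow ℝ (-1)
  have h2 : (fun x : ℝ => ((1 + ‖κ * x‖ ^ 2) ^ (-1 : ℝ) : ℝ)).HasTemperateGrowth :=
    h1.comp (f := fun x : ℝ => κ * x) (by fun_prop)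
  have h3 : (fun x : ℝ => (((1 + ‖κ * x‖ ^ 2) ^ (-1 : ℝ) : ℝ) : ℂ)).HasTemperateGrowth :=
    Function.Complex.hasTemperateGrowth_ofReal.comp h2
  have h5 : (fun x : ℝ => ((κ * x : ℝ) : ℂ)).HasTemperateGrowth :=
    Function.Complex.hasTemperateGrowth_ofReal.comp (f := fun x : ℝ => κ * x) (by fun_prop)
  have h4 : (fun x : ℝ => (1 - Complex.I * ((κ * x : ℝ) : ℂ))).HasTemperateGrowth := by
    fun_prop
  suffices h : (fun x : ℝ => (1 + Complex.I * ↑(κ * x) : ℂ)⁻¹) =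
      (fun x : ℝ => (1 - Complex.I * ((κ * x : ℝ) : ℂ))) *
        fun x : ℝ => (((1 + ‖κ * x‖ ^ 2) ^ (-1 : ℝ) : ℝ) : ℂ) by
    rw [h]
    exact h4.mul h3
  ext x
  have hne : (1 + ((κ * x : ℝ) : ℂ) ^ 2) ≠ 0 := by
    exact_mod_cast (by positivity : (1 + (κ * x) ^ 2 : ℝ) ≠ 0)
  rw [Pi.mul_apply, Real.rpow_neg_one, Real.norm_eq_abs, sq_abs]
  rw [inv_eq_iff_eq_inv, mul_inv]
  push_cast at hne ⊢
  rw [inv_inv]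
  have h0 : (1 - Complex.I * (κ * x) : ℂ) ≠ 0 := by
    have := one_add_I_mul_ne_zero (-(κ * x))
    push_cast at this
    simpa [sub_eq_add_neg] using this
  rw [eq_inv_mul_iff_mul_eq₀ h0]
  linear_combination -(κ ^ 2 * x ^ 2 : ℂ) * Complex.I_sq

variable {T : 𝓢(ℝ, ℂ) →L[ℂ] 𝓢(ℝ, ℂ)} {U : StateSpace ≃ₗᵢ[ℂ] StateSpace}
  {V : 𝓢(ℝ, ℂ) → 𝓢(ℝ, ℂ)} {κ : ℝ}

/-- The unbounded relation is rewritten with the bounded multipliers `r = (1 + iκx)⁻¹` and `s = κx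
(1 + iκx)⁻¹` as `r (U η) = s (U ψ)`, a closed condition. Conversely, `χ ↦ (r χ, s χ)` parametrizes
the maximal graph continuously and sends Schwartz functions into the Schwartz graph, which is
therefore dense in it. -/
theorem closure_graph_ofSchwartz (hV : Function.Surjective V)
    (hUV : ∀ φ, U (schwartzIncl φ) = schwartzIncl (V φ))
    (hT : ∀ φ, V (T φ) = (κ : ℂ) • positionS (V φ)) (p : StateSpace × StateSpace) :
    p ∈ (ofSchwartz T).graph.topologicalClosure ↔
      U p.2 =ᵐ[volume] fun x => ((κ * x : ℝ) : ℂ) * U p.1 x := by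
  set r := mulOp _ (memLp_resolvent κ)
  set s := mulOp _ (memLp_mul_resolvent κ)
  have hr := coeFn_mulOp _ (memLp_resolvent κ)
  have hs := coeFn_mulOp _ (memLp_mul_resolvent κ)
  have hmul : ∀ q : StateSpace × StateSpace,
      U q.2 =ᵐ[volume] (fun x => ((κ * x : ℝ) : ℂ) * U q.1 x) ↔ r (U q.2) = s (U q.1) := by
    intro q
    constructor
    · intro hq
      apply Lp.ext
      filter_upwards [hq, hr (U q.2), hs (U q.1)] with x h1 h2 h3
      rw [h2, h3, h1]
      ring
    · intro hq
      filter_upwards [hr (U q.2), hs (U q.1)] with x h2 h3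
      rw [hq] at h2
      rw [h2, mul_comm _ (_)⁻¹, mul_assoc] at h3
      exact mul_left_cancel₀ (inv_ne_zero (one_add_I_mul_ne_zero _)) h3
  have hgraph : ∀ φ, (U.symm (schwartzIncl φ), U.symm (schwartzIncl ((κ : ℂ) • positionS φ))) ∈
      (ofSchwartz T).graph := by
    intro φ
    obtain ⟨χ, rfl⟩ := hV φ
    rw [ofSchwartz_graph]
    refine ⟨χ, ?_, ?_⟩
    · simp [← hUV]
    · simp [← hT, ← hUV]
  constructor
  · intro hp
    rw [hmul]
    have hcl : IsClosed {q : StateSpace × StateSpace | r (U q.2) = s (U q.1)} :=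
      isClosed_eq (r.continuous.comp (U.continuous.comp continuous_snd))
        (s.continuous.comp (U.continuous.comp continuous_fst))
    refine closure_minimal ?_ hcl hp
    intro q hq
    obtain ⟨φ, h1, h2⟩ := (ofSchwartz_graph T q).1 hq
    change r (U q.2) = s (U q.1)
    rw [← hmul, ← h1, ← h2, hUV, hUV, hT]
    filter_upwards [coeFn_schwartzIncl (V φ),
      coeFn_schwartzIncl ((κ : ℂ) • positionS (V φ))] with x h3 h4
    rw [h3, h4, smul_apply, positionS_apply, smul_eq_mul]
    push_cast
    ring
  · intro hp
    -- The parameter of `p`: since `U p.2 = κx · U p.1`, this is `(1 + iκx) U p.1`, and `r`, `s`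
    -- recover both components.
    set χ : StateSpace := U p.1 + Complex.I • U p.2 with hχ
    have hχx : χ =ᵐ[volume] fun x => (1 + Complex.I * ((κ * x : ℝ) : ℂ)) * U p.1 x := by
      filter_upwards [hp, Lp.coeFn_add (U p.1) (Complex.I • U p.2),
        Lp.coeFn_smul Complex.I (U p.2)] with x h1 h2 h3
      rw [h2, Pi.add_apply, h3, Pi.smul_apply, h1, smul_eq_mul]
      ring
    let Φ : StateSpace → StateSpace × StateSpace := fun f => (U.symm (r f), U.symm (s f))
    have hΦ : Continuous Φ := (U.symm.continuous.comp r.continuous).prodMk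
      (U.symm.continuous.comp s.continuous)
    have hpΦ : p = Φ χ := by
      refine Prod.ext ?_ ?_
      · change p.1 = U.symm (r χ)
        rw [LinearIsometryEquiv.eq_symm_apply]
        apply Lp.ext
        filter_upwards [hr χ, hχx] with x h1 h2
        rw [h1, h2, inv_mul_cancel_left₀ (one_add_I_mul_ne_zero _)]
      · change p.2 = U.symm (s χ)
        rw [LinearIsometryEquiv.eq_symm_apply]
        apply Lp.ext
        filter_upwards [hs χ, hχx, hp] with x h1 h2 h3
        rw [h1, h2, h3, mul_assoc, inv_mul_cancel_left₀ (one_add_I_mul_ne_zero _)]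
    have hmem : χ ∈ closure (Set.range schwartzIncl) := denseRange_schwartzIncl χ
    rw [hpΦ]
    refine map_mem_closure hΦ hmem ?_
    rintro _ ⟨φ, rfl⟩
    have hrφ : r (schwartzIncl φ) = schwartzIncl (SchwartzMap.smulLeftCLM ℂ
        (fun x : ℝ => (1 + Complex.I * ↑(κ * x) : ℂ)⁻¹) φ) := by
      apply Lp.ext
      filter_upwards [hr (schwartzIncl φ), coeFn_schwartzIncl φ,
        coeFn_schwartzIncl (SchwartzMap.smulLeftCLM ℂ
          (fun x : ℝ => (1 + Complex.I * ↑(κ * x) : ℂ)⁻¹) φ)] with x h1 h2 h3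
      rw [h1, h2, h3, SchwartzMap.smulLeftCLM_apply_apply (hasTemperateGrowth_resolvent κ),
        smul_eq_mul]
    have hsφ : s (schwartzIncl φ) = schwartzIncl ((κ : ℂ) • positionS (SchwartzMap.smulLeftCLM ℂ
        (fun x : ℝ => (1 + Complex.I * ↑(κ * x) : ℂ)⁻¹) φ)) := by
      apply Lp.ext
      filter_upwards [hs (schwartzIncl φ), coeFn_schwartzIncl φ,
        coeFn_schwartzIncl ((κ : ℂ) • positionS (SchwartzMap.smulLeftCLM ℂ
          (fun x : ℝ => (1 + Complex.I * ↑(κ * x) : ℂ)⁻¹) φ))] with x h1 h2 h3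
      rw [h1, h2, h3, smul_apply, positionS_apply,
        SchwartzMap.smulLeftCLM_apply_apply (hasTemperateGrowth_resolvent κ),
        smul_eq_mul, smul_eq_mul]
      push_cast
      ring
    have := hgraph (SchwartzMap.smulLeftCLM ℂ
        (fun x : ℝ => (1 + Complex.I * ↑(κ * x) : ℂ)⁻¹) φ)
    rw [← hrφ, ← hsφ] at this
    exact this

theorem isDiagonalization_closure (hV : Function.Surjective V)
    (hUV : ∀ φ, U (schwartzIncl φ) = schwartzIncl (V φ))
    (hT : ∀ φ, V (T φ) = (κ : ℂ) • positionS (V φ)) :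
    IsDiagonalization (ofSchwartz T).closure volume U (fun x => κ * x) := by
  have hmem := closure_graph_ofSchwartz hV hUV hT
  have hcl : (ofSchwartz T).IsClosable := by
    refine ⟨(ofSchwartz T).graph.topologicalClosure.toLinearPMap, ?_⟩
    rw [Submodule.toLinearPMap_graph_eq]
    intro p hp h0
    rw [hmem, h0, map_zero] at hp
    rw [← U.map_eq_zero_iff]
    apply Lp.ext
    filter_upwards [hp, Lp.coeFn_zero ℂ 2 (volume : Measure ℝ)] with x h1 h2
    rw [h1, h2]
    simp
  refine ⟨by fun_prop, fun ψ η => ?_⟩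
  rw [← hcl.graph_closure_eq_closure_graph, hmem]

end Core

/-! ### Diagonalization of `Q cos t + P sin t`. -/

section Coordinate

/-- The unitary that diagonalizes the combination `Q cos t + P sin t` with `cot t = 2πc`. -/
def chirpFourier (c : ℝ) : StateSpace ≃ₗᵢ[ℂ] StateSpace := (chirp c).trans fourierL2

theorem chirpFourier_apply (c : ℝ) (f : StateSpace) :
    chirpFourier c f = fourierL2 (chirp c f) := rfl

theorem chirpFourier_reflection (c a b : ℝ) (f : StateSpace) :
    chirpFourier c (reflection a b f) =
      (phase (-(c / 2 * a ^ 2)) * phase (a * (b + c * a))) •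
        reflection (b + c * a) (-a) (chirpFourier c f) := by
  rw [chirpFourier_apply, chirp_reflection, map_smul, fourierL2_reflection, smul_smul]
  rfl

theorem fourier_momentumS (φ : 𝓢(ℝ, ℂ)) :
    𝓕 (momentumS φ) = ((2 * Real.pi : ℝ) : ℂ) • positionS (𝓕 φ) := by
  have h := SchwartzMap.fourier_lineDerivOp_eq φ (1 : ℝ)
  have hd : momentumS φ = (-Complex.I) • LineDeriv.lineDerivOp (1 : ℝ) φ := by
    ext x
    rw [momentumS_apply, smul_apply, SchwartzMap.lineDerivOp_apply_eq_fderiv, smul_eq_mul,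
      fderiv_apply_one_eq_deriv]
  rw [hd, FourierTransform.fourier_smul, h]
  ext x
  have hg : (fun x : ℝ => inner ℝ x (1 : ℝ)).HasTemperateGrowth := by fun_prop
  rw [smul_apply, smul_apply, smul_apply, positionS_apply,
    SchwartzMap.smulLeftCLM_apply_apply hg]
  simp
  ring_nf
  simp

/-- Differentiating the chirp adds `2πc x` to the momentum; the condition on `c` makes `sin t` times
this term equal to `x cos t`. -/
theorem chirpS_coordinate (c t : ℝ) (hc : 2 * Real.pi * c * Real.sin t = Real.cos t)
    (φ : 𝓢(ℝ, ℂ)) :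
    chirpS c (((Real.cos t : ℂ) • positionS + (Real.sin t : ℂ) • momentumS) φ) =
      (Real.sin t : ℂ) • momentumS (chirpS c φ) := by
  ext x
  have h1 : HasDerivAt (fun y : ℝ => phase (c / 2 * y ^ 2))
      ((c / 2 * (2 * x) : ℝ) • (2 * Real.pi * Complex.I * phase (c / 2 * x ^ 2))) x := by
    have h := (hasDerivAt_phase (c / 2 * x ^ 2)).scomp x (((hasDerivAt_pow 2 x)).const_mul (c / 2))
    simpa [Function.comp_def] using h
  have h2 : HasDerivAt (φ : ℝ → ℂ) (deriv φ x) x := φ.differentiableAt.hasDerivAt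
  have hd : deriv (chirpS c φ : ℝ → ℂ) x =
      ((c / 2 * (2 * x) : ℝ) • (2 * Real.pi * Complex.I * phase (c / 2 * x ^ 2))) * φ x +
        phase (c / 2 * x ^ 2) * deriv φ x := by
    rw [funext (chirpS_apply c φ)]
    exact (h1.mul h2).deriv
  rw [chirpS_apply, smul_apply, momentumS_apply, hd, add_apply, add_apply, smul_apply, smul_apply,
    smul_apply, smul_apply, positionS_apply, momentumS_apply, ← hc]
  simp only [smul_eq_mul, Complex.real_smul]
  push_cast
  ring_nf
  simp only [Complex.I_sq]
  ring

theorem chirpS_surjective (c : ℝ) : Function.Surjective (chirpS c) := fun φ => by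
  refine ⟨chirpS (-c) φ, ?_⟩
  ext x
  rw [chirpS_apply, chirpS_apply, ← mul_assoc, ← phase_add]
  ring_nf
  rw [phase_zero, one_mul]

theorem isDiagonalization_coordinate {c t : ℝ}
    (hc : 2 * Real.pi * c * Real.sin t = Real.cos t) :
    IsDiagonalization (coordinate t) volume (chirpFourier c)
      (fun x => 2 * Real.pi * Real.sin t * x) := by
  refine isDiagonalization_closure (V := fun φ => 𝓕 (chirpS c φ)) ?_ ?_ ?_
  · intro φ
    obtain ⟨χ, hχ⟩ := chirpS_surjective c (𝓕⁻ φ)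
    exact ⟨χ, by simp only [hχ]; exact FourierTransform.fourier_fourierInv_eq φ⟩
  · intro φ
    rw [chirpFourier_apply, chirp_schwartzIncl, fourierL2_schwartzIncl]
  · intro φ
    rw [chirpS_coordinate c t hc, FourierTransform.fourier_smul, fourier_momentumS, smul_smul]
    congr 1
    push_cast
    ring

theorem isDiagonalization_coordinate_of_sin_eq_zero {t : ℝ} (ht : Real.sin t = 0) :
    IsDiagonalization (coordinate t) volume (LinearIsometryEquiv.refl ℂ StateSpace)
      (fun x => Real.cos t * x) := by
  refine isDiagonalization_closure (V := id) Function.surjective_id (fun φ => rfl) fun φ => ?_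
  simp [ht]

theorem exists_isDiagonalization_coordinate (t : ℝ) :
    ∃ (U : StateSpace ≃ₗᵢ[ℂ] StateSpace) (g : ℝ → ℝ),
      IsDiagonalization (coordinate t) volume U g := by
  by_cases ht : Real.sin t = 0
  · exact ⟨_, _, isDiagonalization_coordinate_of_sin_eq_zero ht⟩
  · refine ⟨_, _, isDiagonalization_coordinate (c := Real.cos t / (2 * Real.pi * Real.sin t)) ?_⟩
    have := Real.pi_ne_zero
    field_simp

end Coordinate

/-! ### The Fourier integral on `L¹ ∩ L²`. -/

section Fourier

theorem continuous_fourier_of_integrable {h : ℝ → ℂ} (hh : Integrable h) : Continuous (𝓕 h) :=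
  VectorFourier.fourierIntegral_continuous Real.continuous_fourierChar
    (innerSL ℝ).continuous₂ hh

theorem integral_smul_fourier {h : ℝ → ℂ} (hh : Integrable h) (g : 𝓢(ℝ, ℂ)) :
    ∫ x, g x • 𝓕 h x = ∫ x, (𝓕 g) x • h x := by
  have := VectorFourier.integral_fourierIntegral_smul_eq_flip (L := innerₗ ℝ)
    Real.continuous_fourierChar (innerSL ℝ).continuous₂ (g.integrable (μ := volume)) hh
  rw [flip_innerₗ] at this
  exact this.symm

theorem ae_eq_of_integral_schwartz_smul_eq {f f' : ℝ → ℂ} (hf : LocallyIntegrable f)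
    (hf' : LocallyIntegrable f') (h : ∀ g : 𝓢(ℝ, ℂ), ∫ x, g x • f x = ∫ x, g x • f' x) :
    f =ᵐ[volume] f' := by
  refine ae_eq_of_integral_contDiff_smul_eq hf hf' fun g g_smooth g_cpt => ?_
  have hg₁ : HasCompactSupport (Complex.ofRealCLM ∘ g) := g_cpt.comp_left rfl
  have hg₂ : ContDiff ℝ ((⊤ : ℕ∞) : WithTop ℕ∞) (Complex.ofRealCLM ∘ g) := by fun_prop
  simpa using h (hg₁.toSchwartzMap hg₂)

theorem ae_eq_zero_of_fourier_eq_zero {h : ℝ → ℂ} (hh : Integrable h) (h0 : 𝓕 h = 0) :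
    h =ᵐ[volume] 0 := by
  refine ae_eq_of_integral_schwartz_smul_eq hh.locallyIntegrable
    (integrable_zero ℝ ℂ volume).locallyIntegrable fun g => ?_
  have := integral_smul_fourier hh (𝓕⁻ g)
  rw [FourierTransform.fourier_fourierInv_eq] at this
  rw [← this, h0]
  simp

/-- The `L²` transform and the integral define the same tempered distribution, as testing against
Schwartz functions shows. -/
theorem fourierL2_toLp {h : ℝ → ℂ} (h1 : Integrable h) (h2 : MemLp h 2) :
    fourierL2 (h2.toLp h) =ᵐ[volume] 𝓕 h := by
  refine ae_eq_of_integral_schwartz_smul_eq ((Lp.memLp _).locallyIntegrable (by norm_num))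
    (continuous_fourier_of_integrable h1).locallyIntegrable fun g => ?_
  rw [integral_smul_fourier h1]
  have e := congrArg (fun T : 𝓢'(ℝ, ℂ) => T g)
    (Lp.fourier_toTemperedDistribution_eq (h2.toLp h : StateSpace))
  simp only [TemperedDistribution.fourier_apply, Lp.toTemperedDistribution_apply] at e
  refine e.symm.trans (integral_congr_ae ?_)
  filter_upwards [h2.coeFn_toLp] with x hx
  rw [hx]

theorem lintegral_fourier_sq {h : ℝ → ℂ} (h1 : Integrable h) (h2 : MemLp h 2) :
    ∫⁻ w, ‖𝓕 h w‖ₑ ^ 2 = ∫⁻ x, ‖h x‖ₑ ^ 2 := by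
  have e : ‖fourierL2 (h2.toLp h)‖ₑ ^ 2 = ‖(h2.toLp h : StateSpace)‖ₑ ^ 2 := by
    rw [fourierL2.enorm_map]
  rw [enorm_sq_eq_lintegral, enorm_sq_eq_lintegral] at e
  calc ∫⁻ w, ‖𝓕 h w‖ₑ ^ 2 = ∫⁻ w, ‖fourierL2 (h2.toLp h) w‖ₑ ^ 2 := by
        apply lintegral_congr_ae
        filter_upwards [fourierL2_toLp h1 h2] with x hx
        rw [hx]
    _ = _ := e
    _ = ∫⁻ x, ‖h x‖ₑ ^ 2 := by
        apply lintegral_congr_ae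
        filter_upwards [h2.coeFn_toLp] with x hx
        rw [hx]

end Fourier

/-! ### The cross-Wigner function and its marginals. -/

section Ambiguity

/-- Joint strong continuity makes the phase-space integrands measurable and the image of a compact
square compact. -/
theorem continuous_reflection (χ : StateSpace) :
    Continuous fun p : ℝ × ℝ => reflection p.1 p.2 χ := by
  let M : ℝ → StateSpace ≃ₗᵢ[ℂ] StateSpace := fun b => mulUnitary (fun x : ℝ => phase (b * x))
    (continuous_phase.comp (by fun_prop)).measurable fun _ => norm_phase _
  let τ : ℝ → StateSpace := fun a => Lp.compMeasurePreserving (fun x : ℝ => a - x)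
    (Measure.measurePreserving_sub_left volume a) χ
  have hR : ∀ p : ℝ × ℝ, reflection p.1 p.2 χ = M p.2 (τ p.1) := fun p => rfl
  have hτ : Continuous τ := by
    let G : C(ℝ, C(ℝ, ℝ)) := ContinuousMap.curry ⟨fun p : ℝ × ℝ => p.1 - p.2, by fun_prop⟩
    exact (continuous_const (y := χ)).compMeasurePreservingLp (g := G) G.continuous
      (fun a => Measure.measurePreserving_sub_left volume a) (by norm_num)
  have hM : ∀ f : StateSpace, Continuous fun b => M b f := by
    intro f
    rw [continuous_iff_continuousAt]
    intro b
    refine tendsto_of_mul 1 (fun b => coeFn_mulUnitary _ _ _ f) (coeFn_mulUnitary _ _ _ f)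
      (fun b x => (norm_phase _).le) fun x => ?_
    exact (continuous_phase.comp (continuous_id.mul continuous_const)).tendsto b
  rw [continuous_iff_continuousAt]
  rintro ⟨a, b⟩
  simp only [hR]
  rw [ContinuousAt, tendsto_iff_norm_sub_tendsto_zero]
  have h1 : Tendsto (fun p : ℝ × ℝ => ‖τ p.1 - τ a‖ + ‖M p.2 (τ a) - M b (τ a)‖) (𝓝 (a, b))
      (𝓝 (‖τ a - τ a‖ + ‖M b (τ a) - M b (τ a)‖)) :=
    Continuous.tendsto (((hτ.comp continuous_fst).sub continuous_const).norm.add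
      ((((hM (τ a)).comp continuous_snd).sub continuous_const).norm)) (a, b)
  simp only [sub_self, norm_zero, add_zero] at h1
  refine squeeze_zero (fun _ => norm_nonneg _) (fun p => ?_) h1
  calc ‖M p.2 (τ p.1) - M b (τ a)‖
      ≤ ‖M p.2 (τ p.1) - M p.2 (τ a)‖ + ‖M p.2 (τ a) - M b (τ a)‖ :=
        norm_sub_le_norm_sub_add_norm_sub _ _ _
    _ = _ := by rw [← map_sub, LinearIsometryEquiv.norm_map]

theorem measurable_ambiguity (χ ψ : StateSpace) :
    Measurable fun p : ℝ × ℝ => ‖⟪reflection p.1 p.2 χ, ψ⟫_ℂ‖ₑ ^ 2 :=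
  ((continuous_reflection χ).inner continuous_const).enorm.measurable.pow_const 2

theorem lintegral_lintegral_convolution {F G : ℝ → ℝ≥0∞} (hF : Measurable F) (hG : Measurable G) :
    ∫⁻ s, ∫⁻ ξ, F (s - ξ) * G ξ = (∫⁻ x, F x) * ∫⁻ x, G x := by
  rw [lintegral_lintegral_swap
    ((hF.comp (measurable_fst.sub measurable_snd)).mul (hG.comp measurable_snd)).aemeasurable]
  rw [← lintegral_const_mul _ hG]
  refine lintegral_congr fun ξ => ?_
  have hm : Measurable fun s => F (s - ξ) := hF.comp (measurable_sub_const ξ)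
  rw [lintegral_mul_const _ hm, lintegral_sub_right_eq_self F ξ]

theorem integrable_conj_mul (s : ℝ) (χ ψ : StateSpace) :
    Integrable fun ξ => conj (χ (s - ξ)) * ψ ξ := by
  have hp := Measure.measurePreserving_sub_left (volume : Measure ℝ) s
  have h1 : MemLp (fun ξ => χ (s - ξ)) 2 := (Lp.memLp χ).comp_measurePreserving hp
  exact h1.star.integrable_mul (Lp.memLp ψ)

theorem inner_reflection (s b : ℝ) (χ ψ : StateSpace) :
    ⟪reflection s b χ, ψ⟫_ℂ = 𝓕 (fun ξ => conj (χ (s - ξ)) * ψ ξ) b := by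
  rw [fourier_eq_phase, L2.inner_def]
  apply integral_congr_ae
  filter_upwards [coeFn_reflection s b χ] with x hx
  rw [hx, RCLike.inner_apply, map_mul, ← phase_neg, mul_comm b x]
  ring

/-- For fixed `s` the function of `b` is the Fourier transform of `conj (χ (s - ξ)) * ψ ξ`, so this
is Plancherel. The product is in `L²` only for almost every `s`, by finiteness of the convolution
integral. -/
theorem ae_lintegral_ambiguity (χ ψ : StateSpace) :
    ∀ᵐ s : ℝ, ∫⁻ b, ‖⟪reflection s b χ, ψ⟫_ℂ‖ₑ ^ 2 =
      ∫⁻ ξ, ‖χ (s - ξ)‖ₑ ^ 2 * ‖ψ ξ‖ₑ ^ 2 := by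
  have hχ : Measurable fun x => ‖χ x‖ₑ ^ 2 :=
    ((Lp.stronglyMeasurable χ).measurable.enorm.pow_const 2)
  have hψ : Measurable fun x => ‖ψ x‖ₑ ^ 2 :=
    ((Lp.stronglyMeasurable ψ).measurable.enorm.pow_const 2)
  have htot := lintegral_lintegral_convolution hχ hψ
  rw [← enorm_sq_eq_lintegral, ← enorm_sq_eq_lintegral] at htot
  have hmeas : Measurable fun s => ∫⁻ ξ, ‖χ (s - ξ)‖ₑ ^ 2 * ‖ψ ξ‖ₑ ^ 2 :=
    Measurable.lintegral_prod_right' (f := fun p : ℝ × ℝ => ‖χ (p.1 - p.2)‖ₑ ^ 2 * ‖ψ p.2‖ₑ ^ 2)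
      ((hχ.comp (measurable_fst.sub measurable_snd)).mul (hψ.comp measurable_snd))
  have hfin := ae_lt_top hmeas (by rw [htot]; finiteness)
  filter_upwards [hfin] with s hs
  simp only [inner_reflection]
  have h1 := integrable_conj_mul s χ ψ
  have e : ∀ ξ, ‖conj (χ (s - ξ)) * ψ ξ‖ₑ ^ 2 = ‖χ (s - ξ)‖ₑ ^ 2 * ‖ψ ξ‖ₑ ^ 2 := fun ξ => by
    rw [enorm_mul, mul_pow, RCLike.enorm_conj]
  have h2 : MemLp (fun ξ => conj (χ (s - ξ)) * ψ ξ) 2 := by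
    refine ⟨h1.aestronglyMeasurable, ?_⟩
    rw [eLpNorm_lt_top_iff_lintegral_rpow_enorm_lt_top (by simp) (by simp)]
    simpa [mul_pow] using hs
  rw [lintegral_fourier_sq h1 h2]
  exact lintegral_congr e

end Ambiguity

/-! ### Mass estimates in the phase plane. -/

section PhaseSpace

theorem measurable_enorm_sq (f : StateSpace) : Measurable fun x => ‖f x‖ₑ ^ 2 :=
  (Lp.stronglyMeasurable f).measurable.enorm.pow_const 2

theorem lintegral_ambiguity_eq (χ ψ : StateSpace) (W : ℝ → ℝ≥0∞) :
    ∫⁻ s, W s * ∫⁻ b, ‖⟪reflection s b χ, ψ⟫_ℂ‖ₑ ^ 2 =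
      ∫⁻ s, W s * ∫⁻ ξ, ‖χ (s - ξ)‖ₑ ^ 2 * ‖ψ ξ‖ₑ ^ 2 := by
  apply lintegral_congr_ae
  filter_upwards [ae_lintegral_ambiguity χ ψ] with s hs
  rw [hs]

theorem lintegral_ambiguity (χ ψ : StateSpace) :
    ∫⁻ s, ∫⁻ b, ‖⟪reflection s b χ, ψ⟫_ℂ‖ₑ ^ 2 = ‖χ‖ₑ ^ 2 * ‖ψ‖ₑ ^ 2 := by
  have := lintegral_ambiguity_eq χ ψ 1
  simp only [Pi.one_apply, one_mul] at this
  rw [this, lintegral_lintegral_convolution (measurable_enorm_sq χ) (measurable_enorm_sq ψ),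
    ← enorm_sq_eq_lintegral, ← enorm_sq_eq_lintegral]

/-- The marginal is a convolution and `s = (s - ξ) + ξ`: if `κ s < -R`, then either `κ ξ ≤ 0`, which
costs mass of `ψ`, or `κ (s - ξ) < -R`, which costs a tail of `χ`. -/
theorem lintegral_halfPlane_le (χ ψ : StateSpace) (κ R : ℝ) :
    ∫⁻ s, {x | κ * x < -R}.indicator 1 s * ∫⁻ b, ‖⟪reflection s b χ, ψ⟫_ℂ‖ₑ ^ 2 ≤
      (∫⁻ x in {x | κ * x < -R}, ‖χ x‖ₑ ^ 2) * ‖ψ‖ₑ ^ 2 +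
        ‖χ‖ₑ ^ 2 * ∫⁻ x in {x | κ * x ≤ 0}, ‖ψ x‖ₑ ^ 2 := by
  have hA : MeasurableSet {x : ℝ | κ * x < -R} :=
    measurableSet_lt (by fun_prop) measurable_const
  have hB : MeasurableSet {x : ℝ | κ * x ≤ 0} :=
    measurableSet_le (by fun_prop) measurable_const
  have hχ := measurable_enorm_sq χ
  have hψ := measurable_enorm_sq ψ
  rw [lintegral_ambiguity_eq, enorm_sq_eq_lintegral χ, enorm_sq_eq_lintegral ψ,
    ← lintegral_indicator hA, ← lintegral_indicator hB,
    ← lintegral_lintegral_convolution (hχ.indicator hA) hψ,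
    ← lintegral_lintegral_convolution hχ (hψ.indicator hB)]
  have hm : Measurable fun s => ∫⁻ ξ, {x | κ * x < -R}.indicator (fun x => ‖χ x‖ₑ ^ 2) (s - ξ) *
      ‖ψ ξ‖ₑ ^ 2 :=
    Measurable.lintegral_prod_right' (f := fun p : ℝ × ℝ =>
      {x | κ * x < -R}.indicator (fun x => ‖χ x‖ₑ ^ 2) (p.1 - p.2) * ‖ψ p.2‖ₑ ^ 2)
      (((hχ.indicator hA).comp (measurable_fst.sub measurable_snd)).mul (hψ.comp measurable_snd))
  rw [← lintegral_add_left hm]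
  refine lintegral_mono fun s => ?_
  have hm' : Measurable fun ξ => {x | κ * x < -R}.indicator (fun x => ‖χ x‖ₑ ^ 2) (s - ξ) *
      ‖ψ ξ‖ₑ ^ 2 :=
    ((hχ.indicator hA).comp (measurable_const.sub measurable_id)).mul hψ
  simp only
  rw [← lintegral_add_left hm']
  by_cases hs : κ * s < -R
  · rw [Set.indicator_of_mem (by exact hs), Pi.one_apply, one_mul]
    refine lintegral_mono fun ξ => ?_
    by_cases hξ : κ * ξ ≤ 0
    · rw [Set.indicator_of_mem (s := {x | κ * x ≤ 0}) (by exact hξ)]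
      exact le_add_self
    · have hsξ : κ * (s - ξ) < -R := by
        rw [mul_sub]
        push Not at hξ
        linarith
      rw [Set.indicator_of_mem (s := {x | κ * x < -R}) (by exact hsξ)]
      exact le_self_add
  · rw [Set.indicator_of_notMem (by exact hs), zero_mul]
    exact zero_le

theorem tendsto_tail (χ : StateSpace) (κ : ℝ) :
    Tendsto (fun n : ℕ => ∫⁻ x in {x | κ * x < -(n : ℝ)}, ‖χ x‖ₑ ^ 2) atTop (𝓝 0) := by
  have hA : ∀ n : ℕ, MeasurableSet {x : ℝ | κ * x < -(n : ℝ)} := fun n =>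
    measurableSet_lt (by fun_prop) measurable_const
  rw [funext fun n => (lintegral_indicator (hA n) (fun x => ‖χ x‖ₑ ^ 2)).symm,
    ← lintegral_zero (μ := (volume : Measure ℝ))]
  refine tendsto_lintegral_of_dominated_convergence (fun x => ‖χ x‖ₑ ^ 2)
    (fun n => (measurable_enorm_sq χ).indicator (hA n)) ?_ ?_ ?_
  · exact fun n => Eventually.of_forall fun x => Set.indicator_le_self _ _ x
  · rw [← enorm_sq_eq_lintegral]
    finiteness
  · refine Eventually.of_forall fun x => ?_
    apply tendsto_const_nhds.congr'
    obtain ⟨N, hN⟩ := exists_nat_gt (-(κ * x))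
    filter_upwards [eventually_ge_atTop N] with n hn
    rw [Set.indicator_of_notMem]
    have : (N : ℝ) ≤ n := by exact_mod_cast hn
    simp only [Set.mem_ofPred_eq, not_lt]
    linarith

/-- The map `(q, b) ↦ (b + c q, -q)` preserves area. -/
theorem lintegral_shear (c : ℝ) {N : ℝ → ℝ → ℝ≥0∞} (hN : Measurable fun p : ℝ × ℝ => N p.1 p.2)
    {W : ℝ → ℝ≥0∞} (hW : Measurable W) :
    ∫⁻ q, ∫⁻ b, W (b + c * q) * N (b + c * q) (-q) = ∫⁻ s, W s * ∫⁻ b, N s b := by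
  have hN' : Measurable fun p : ℝ × ℝ => W p.2 * N p.2 (-p.1) :=
    (hW.comp measurable_snd).mul (hN.comp (measurable_snd.prodMk measurable_fst.neg))
  calc _ = ∫⁻ q, ∫⁻ s, W s * N s (-q) := by
        refine lintegral_congr fun q => ?_
        exact lintegral_add_right_eq_self (fun s => W s * N s (-q)) (c * q)
    _ = ∫⁻ s, ∫⁻ q, W s * N s (-q) := lintegral_lintegral_swap hN'.aemeasurable
    _ = ∫⁻ s, W s * ∫⁻ b, N s b := by
        refine lintegral_congr fun s => ?_
        have hs : Measurable fun b => N s b := hN.comp (measurable_const.prodMk measurable_id)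
        have hs' : Measurable fun q => N s (-q) := hs.comp measurable_neg
        rw [lintegral_const_mul _ hs', lintegral_neg_eq_self (fun b => N s b)]

theorem enorm_inner_reflection_chart (c q b : ℝ) (φ ψ : StateSpace) :
    ‖⟪reflection q b φ, ψ⟫_ℂ‖ₑ =
      ‖⟪reflection (b + c * q) (-q) (chirpFourier c φ), chirpFourier c ψ⟫_ℂ‖ₑ := by
  have h1 : ‖phase (-(c / 2 * q ^ 2)) * phase (q * (b + c * q))‖ₑ = 1 := by
    rw [enorm_mul, ← ofReal_norm, ← ofReal_norm, norm_phase, norm_phase]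
    simp
  rw [← (chirpFourier c).inner_map_map, chirpFourier_reflection, inner_smul_left, enorm_mul,
    RCLike.enorm_conj, h1, one_mul]

/-- Covariance under `chirpFourier` turns an oblique half-plane into one in the first coordinate,
where `lintegral_halfPlane_le` applies. -/
theorem lintegral_chart (c : ℝ) (φ ψ : StateSpace) {W : ℝ → ℝ≥0∞} (hW : Measurable W) :
    ∫⁻ q, ∫⁻ b, W (b + c * q) * ‖⟪reflection q b φ, ψ⟫_ℂ‖ₑ ^ 2 =
      ∫⁻ s, W s * ∫⁻ b, ‖⟪reflection s b (chirpFourier c φ), chirpFourier c ψ⟫_ℂ‖ₑ ^ 2 := by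
  rw [← lintegral_shear c (measurable_ambiguity (chirpFourier c φ) (chirpFourier c ψ)) hW]
  refine lintegral_congr fun q => lintegral_congr fun b => ?_
  rw [enorm_inner_reflection_chart c]

/-- The reflections of `φ` over the square form a compact set, so a finite `δ`-net `t` replaces them
all with error `δ ‖ψ‖`. -/
theorem lintegral_compact_le (φ : StateSpace) (R ε : ℝ) (hε : 0 < ε) :
    ∃ (C : ℝ) (t : Finset StateSpace), 0 ≤ C ∧ ∀ ψ : StateSpace,
      ∫⁻ q in Set.Icc (-R) R, ∫⁻ b in Set.Icc (-R) R, ‖⟪reflection q b φ, ψ⟫_ℂ‖ₑ ^ 2 ≤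
        ENNReal.ofReal (ε * ‖ψ‖ ^ 2 + C * ∑ y ∈ t, ‖⟪y, ψ⟫_ℂ‖ ^ 2) := by
  -- The area of the square, plus one to keep it positive when the square is empty or a point; `δ`
  -- is then tuned so that `2 δ² v = ε`.
  set v : ℝ := (max (2 * R) 0) ^ 2 + 1 with hv
  have hvpos : 0 < v := by positivity
  set δ : ℝ := Real.sqrt (ε / (2 * v)) with hδ
  have hδpos : 0 < δ := Real.sqrt_pos.2 (by positivity)
  have hδ2 : 2 * δ ^ 2 * v = ε := by
    rw [hδ, Real.sq_sqrt (by positivity)]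
    field_simp
  set K : Set StateSpace :=
    (fun p : ℝ × ℝ => reflection p.1 p.2 φ) '' (Set.Icc (-R) R ×ˢ Set.Icc (-R) R)
  have hK : IsCompact K := (isCompact_Icc.prod isCompact_Icc).image (continuous_reflection φ)
  obtain ⟨t, -, htf, hcov⟩ := hK.finite_cover_balls hδpos
  lift t to Finset StateSpace using htf
  refine ⟨2 * v, t, by positivity, fun ψ => ?_⟩
  set B : ℝ := 2 * δ ^ 2 * ‖ψ‖ ^ 2 + 2 * ∑ y ∈ t, ‖⟪y, ψ⟫_ℂ‖ ^ 2
  have hB : 0 ≤ B := by positivity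
  have hpt : ∀ q ∈ Set.Icc (-R) R, ∀ b ∈ Set.Icc (-R) R,
      ‖⟪reflection q b φ, ψ⟫_ℂ‖ₑ ^ 2 ≤ ENNReal.ofReal B := by
    intro q hq b hb
    have hmem : reflection q b φ ∈ K := ⟨(q, b), ⟨hq, hb⟩, rfl⟩
    have := hcov hmem
    simp only [Set.mem_iUnion, Metric.mem_ball, exists_prop] at this
    obtain ⟨y, hy, hd⟩ := this
    rw [dist_eq_norm] at hd
    have h1 : ‖⟪reflection q b φ, ψ⟫_ℂ‖ ≤ δ * ‖ψ‖ + ‖⟪y, ψ⟫_ℂ‖ := by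
      have e : ⟪reflection q b φ, ψ⟫_ℂ = ⟪reflection q b φ - y, ψ⟫_ℂ + ⟪y, ψ⟫_ℂ := by
        rw [← inner_add_left, sub_add_cancel]
      rw [e]
      refine (norm_add_le _ _).trans ?_
      gcongr
      exact (norm_inner_le_norm _ _).trans (by gcongr)
    have h2 : ‖⟪y, ψ⟫_ℂ‖ ^ 2 ≤ ∑ y ∈ t, ‖⟪y, ψ⟫_ℂ‖ ^ 2 :=
      Finset.single_le_sum (f := fun y => ‖⟪y, ψ⟫_ℂ‖ ^ 2) (fun _ _ => by positivity) hy
    have h3 : ‖⟪reflection q b φ, ψ⟫_ℂ‖ ^ 2 ≤ B := by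
      calc ‖⟪reflection q b φ, ψ⟫_ℂ‖ ^ 2 ≤ (δ * ‖ψ‖ + ‖⟪y, ψ⟫_ℂ‖) ^ 2 := by gcongr
        _ ≤ 2 * δ ^ 2 * ‖ψ‖ ^ 2 + 2 * ‖⟪y, ψ⟫_ℂ‖ ^ 2 := by
            nlinarith [sq_nonneg (δ * ‖ψ‖ - ‖⟪y, ψ⟫_ℂ‖)]
        _ ≤ B := by linarith
    rw [← ofReal_norm, ← ENNReal.ofReal_pow (norm_nonneg _)]
    exact ENNReal.ofReal_le_ofReal h3
  have hvol : volume (Set.Icc (-R) R) = ENNReal.ofReal (max (2 * R) 0) := by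
    rw [Real.volume_Icc]
    rcases le_total 0 R with h | h
    · rw [max_eq_left (by linarith)]
      ring_nf
    · rw [max_eq_right (by linarith), ENNReal.ofReal_of_nonpos (by linarith), ENNReal.ofReal_zero]
  calc ∫⁻ q in Set.Icc (-R) R, ∫⁻ b in Set.Icc (-R) R, ‖⟪reflection q b φ, ψ⟫_ℂ‖ₑ ^ 2
      ≤ ∫⁻ _ in Set.Icc (-R) R, ∫⁻ _ in Set.Icc (-R) R, ENNReal.ofReal B :=
        setLIntegral_mono' measurableSet_Icc fun q hq =>
          setLIntegral_mono' measurableSet_Icc fun b hb => hpt q hq b hb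
    _ = ENNReal.ofReal (B * (max (2 * R) 0) ^ 2) := by
        rw [setLIntegral_const, setLIntegral_const, hvol, mul_assoc,
          ← ENNReal.ofReal_mul (le_max_right _ _), ← ENNReal.ofReal_mul hB]
        ring_nf
    _ ≤ _ := by
        apply ENNReal.ofReal_le_ofReal
        calc B * (max (2 * R) 0) ^ 2 ≤ B * v := by gcongr; linarith
          _ = (2 * δ ^ 2 * v) * ‖ψ‖ ^ 2 + 2 * v * ∑ y ∈ t, ‖⟪y, ψ⟫_ℂ‖ ^ 2 := by ring
          _ = _ := by rw [hδ2]

end PhaseSpace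

/-! ### Three half-planes cover the complement of a bounded set. -/

section Coercivity

theorem sin_two_pi_div_three : Real.sin (2 * Real.pi / 3) = Real.sqrt 3 / 2 := by
  rw [show 2 * Real.pi / 3 = Real.pi - Real.pi / 3 by ring, Real.sin_pi_sub, Real.sin_pi_div_three]

theorem cos_two_pi_div_three : Real.cos (2 * Real.pi / 3) = -1 / 2 := by
  rw [show 2 * Real.pi / 3 = Real.pi - Real.pi / 3 by ring, Real.cos_pi_sub, Real.cos_pi_div_three]
  norm_num

theorem sin_four_pi_div_three : Real.sin (4 * Real.pi / 3) = -(Real.sqrt 3 / 2) := by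
  rw [show 4 * Real.pi / 3 = Real.pi / 3 + Real.pi by ring, Real.sin_add_pi,
    Real.sin_pi_div_three]

theorem cos_four_pi_div_three : Real.cos (4 * Real.pi / 3) = -1 / 2 := by
  rw [show 4 * Real.pi / 3 = Real.pi / 3 + Real.pi by ring, Real.cos_add_pi,
    Real.cos_pi_div_three]
  norm_num

/-- The rate of the chirp that diagonalizes the coordinate at the time `4π/3`. -/
def chirpRate : ℝ := 1 / (2 * Real.pi * Real.sqrt 3)

theorem isDiagonalization_coordinate_zero :
    IsDiagonalization (coordinate 0) volume (LinearIsometryEquiv.refl ℂ StateSpace)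
      (fun x => 1 * x) := by
  simpa using isDiagonalization_coordinate_of_sin_eq_zero Real.sin_zero

theorem isDiagonalization_coordinate_two_pi_div_three :
    IsDiagonalization (coordinate (2 * Real.pi / 3)) volume (chirpFourier (-chirpRate))
      (fun x => Real.pi * Real.sqrt 3 * x) := by
  have h3 : Real.sqrt 3 ≠ 0 := by positivity
  have h := isDiagonalization_coordinate (c := -chirpRate) (t := 2 * Real.pi / 3) (by
    rw [sin_two_pi_div_three, cos_two_pi_div_three, chirpRate]
    field_simp)
  rw [sin_two_pi_div_three] at h
  convert h using 2
  ring

theorem isDiagonalization_coordinate_four_pi_div_three :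
    IsDiagonalization (coordinate (4 * Real.pi / 3)) volume (chirpFourier chirpRate)
      (fun x => -(Real.pi * Real.sqrt 3) * x) := by
  have h3 : Real.sqrt 3 ≠ 0 := by positivity
  have h := isDiagonalization_coordinate (c := chirpRate) (t := 4 * Real.pi / 3) (by
    rw [sin_four_pi_div_three, cos_four_pi_div_three, chirpRate]
    field_simp)
  rw [sin_four_pi_div_three] at h
  convert h using 2
  ring

theorem enorm_sub_sq_eq {κ : ℝ} {U : StateSpace ≃ₗᵢ[ℂ] StateSpace} {E : StateSpace →L[ℂ] StateSpace}
    (h : Diagonalizes U (fun x => theta (κ * x)) E) (ψ : StateSpace) :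
    ∫⁻ x in {x | κ * x ≤ 0}, ‖U ψ x‖ₑ ^ 2 = ‖ψ - E ψ‖ₑ ^ 2 := by
  have hB : MeasurableSet {x : ℝ | κ * x ≤ 0} :=
    measurableSet_le (by fun_prop) measurable_const
  rw [← U.enorm_map, enorm_sq_eq_lintegral, map_sub, ← lintegral_indicator hB]
  apply lintegral_congr_ae
  filter_upwards [h ψ, Lp.coeFn_sub (U ψ) (U (E ψ))] with x h1 h2
  rw [h2, Pi.sub_apply, h1, theta]
  by_cases hx : κ * x ≤ 0
  · rw [Set.indicator_of_mem (by exact hx), if_neg (not_lt.2 hx)]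
    simp
  · rw [Set.indicator_of_notMem (by exact hx), if_pos (not_le.1 hx)]
    simp

/-- With `K = π√3` the three forms are `q`, `K b - q/2` and `-K b - q/2`. They sum to zero, so lower
bounds `-R` on all of them give upper bounds `2R`, and `K ≥ 1` passes the bound to `b`. -/
theorem plane_subset (R q b : ℝ) (hq : ¬ 1 * q < -R)
    (h1 : ¬ Real.pi * Real.sqrt 3 * (b + -chirpRate * q) < -R)
    (h2 : ¬ -(Real.pi * Real.sqrt 3) * (b + chirpRate * q) < -R) :
    q ∈ Set.Icc (-(2 * R)) (2 * R) ∧ b ∈ Set.Icc (-(2 * R)) (2 * R) := by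
  have h3 : Real.sqrt 3 ≠ 0 := by positivity
  have hk : Real.pi * Real.sqrt 3 * chirpRate = 1 / 2 := by
    rw [chirpRate]
    field_simp
  have hK : 1 ≤ Real.pi * Real.sqrt 3 := by
    have := Real.pi_gt_three
    have : 1 ≤ Real.sqrt 3 := Real.one_le_sqrt.2 (by norm_num)
    nlinarith
  have e1 : Real.pi * Real.sqrt 3 * (b + -chirpRate * q) = Real.pi * Real.sqrt 3 * b - q / 2 := by
    linear_combination (-q) * hk
  have e2 : -(Real.pi * Real.sqrt 3) * (b + chirpRate * q) =
      -(Real.pi * Real.sqrt 3 * b) - q / 2 := by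
    linear_combination (-q) * hk
  rw [e1, not_lt] at h1
  rw [e2, not_lt] at h2
  rw [not_lt] at hq
  set K := Real.pi * Real.sqrt 3
  have hR : 0 ≤ R := by linarith
  refine ⟨⟨by linarith, by linarith⟩, ?_, ?_⟩
  · by_contra hb
    rw [not_le] at hb
    nlinarith
  · by_contra hb
    rw [not_le] at hb
    nlinarith

theorem lintegral_indicator_one_mul {X : Type*} [MeasurableSpace X] {μ : Measure X} {s : Set X}
    (hs : MeasurableSet s) (f : X → ℝ≥0∞) :
    ∫⁻ x, s.indicator 1 x * f x ∂μ = ∫⁻ x in s, f x ∂μ := by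
  rw [← lintegral_indicator hs]
  refine lintegral_congr fun x => ?_
  by_cases hx : x ∈ s <;> simp [hx]

theorem lintegral_lintegral_le_of_cover {N : ℝ → ℝ → ℝ≥0∞}
    (hN : Measurable fun p : ℝ × ℝ => N p.1 p.2) {W₀ W₁ W₂ I : ℝ → ℝ≥0∞} (h₀ : Measurable W₀)
    (h₁ : Measurable W₁) (h₂ : Measurable W₂) (hI : Measurable I) (c₁ c₂ : ℝ)
    (hcov : ∀ q b, 1 ≤ W₀ q + W₁ (b + c₁ * q) + W₂ (b + c₂ * q) + I q * I b) :
    ∫⁻ q, ∫⁻ b, N q b ≤ (∫⁻ q, W₀ q * ∫⁻ b, N q b) + (∫⁻ q, ∫⁻ b, W₁ (b + c₁ * q) * N q b) +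
      (∫⁻ q, ∫⁻ b, W₂ (b + c₂ * q) * N q b) + ∫⁻ q, I q * ∫⁻ b, I b * N q b := by
  have hp : Measurable fun p : ℝ × ℝ => W₁ (p.2 + c₁ * p.1) * N p.1 p.2 :=
    (h₁.comp (by fun_prop)).mul hN
  have hp' : Measurable fun p : ℝ × ℝ => W₂ (p.2 + c₂ * p.1) * N p.1 p.2 :=
    (h₂.comp (by fun_prop)).mul hN
  have hp₀ : Measurable fun p : ℝ × ℝ => W₀ p.1 * N p.1 p.2 := (h₀.comp measurable_fst).mul hN
  have hpI : Measurable fun p : ℝ × ℝ => I p.1 * (I p.2 * N p.1 p.2) :=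
    (hI.comp measurable_fst).mul ((hI.comp measurable_snd).mul hN)
  have hs : ∀ q, Measurable fun b => N q b := fun q =>
    hN.comp (measurable_const.prodMk measurable_id)
  have e₀ : ∫⁻ q, W₀ q * ∫⁻ b, N q b = ∫⁻ q, ∫⁻ b, W₀ q * N q b :=
    lintegral_congr fun q => (lintegral_const_mul _ (hs q)).symm
  have eI : ∫⁻ q, I q * ∫⁻ b, I b * N q b = ∫⁻ q, ∫⁻ b, I q * (I b * N q b) :=
    lintegral_congr fun q => (lintegral_const_mul _ (hI.mul (hs q))).symm
  rw [e₀, eI, ← lintegral_prod (fun p : ℝ × ℝ => N p.1 p.2) hN.aemeasurable,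
    ← lintegral_prod (fun p : ℝ × ℝ => W₀ p.1 * N p.1 p.2) hp₀.aemeasurable,
    ← lintegral_prod (fun p : ℝ × ℝ => W₁ (p.2 + c₁ * p.1) * N p.1 p.2) hp.aemeasurable,
    ← lintegral_prod (fun p : ℝ × ℝ => W₂ (p.2 + c₂ * p.1) * N p.1 p.2) hp'.aemeasurable,
    ← lintegral_prod (fun p : ℝ × ℝ => I p.1 * (I p.2 * N p.1 p.2)) hpI.aemeasurable,
    ← lintegral_add_right _ hp, ← lintegral_add_right _ hp', ← lintegral_add_right _ hpI]
  refine lintegral_mono fun p => ?_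
  calc N p.1 p.2 = 1 * N p.1 p.2 := (one_mul _).symm
    _ ≤ (W₀ p.1 + W₁ (p.2 + c₁ * p.1) + W₂ (p.2 + c₂ * p.1) + I p.1 * I p.2) * N p.1 p.2 :=
        mul_le_mul_left (hcov p.1 p.2) _
    _ = _ := by ring

/-- Moyal's total mass is split over the three half-planes, each estimated in its own chart, and the
remaining square. -/
theorem phaseSpace_inequality (φ ψ : StateSpace) (R : ℝ) :
    ‖φ‖ₑ ^ 2 * ‖ψ‖ₑ ^ 2 ≤
      ((∫⁻ x in {x | 1 * x < -R}, ‖φ x‖ₑ ^ 2) * ‖ψ‖ₑ ^ 2 +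
        ‖φ‖ₑ ^ 2 * ‖ψ - projPos 0 ψ‖ₑ ^ 2) +
      ((∫⁻ x in {x | Real.pi * Real.sqrt 3 * x < -R}, ‖chirpFourier (-chirpRate) φ x‖ₑ ^ 2) *
          ‖ψ‖ₑ ^ 2 + ‖φ‖ₑ ^ 2 * ‖ψ - projPos (2 * Real.pi / 3) ψ‖ₑ ^ 2) +
      ((∫⁻ x in {x | -(Real.pi * Real.sqrt 3) * x < -R}, ‖chirpFourier chirpRate φ x‖ₑ ^ 2) *
          ‖ψ‖ₑ ^ 2 + ‖φ‖ₑ ^ 2 * ‖ψ - projPos (4 * Real.pi / 3) ψ‖ₑ ^ 2) +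
      ∫⁻ q in Set.Icc (-(2 * R)) (2 * R), ∫⁻ b in Set.Icc (-(2 * R)) (2 * R),
        ‖⟪reflection q b φ, ψ⟫_ℂ‖ₑ ^ 2 := by
  have hA : ∀ κ : ℝ, Measurable ({x : ℝ | κ * x < -R}.indicator (1 : ℝ → ℝ≥0∞)) := fun κ =>
    measurable_one.indicator (measurableSet_lt (by fun_prop) measurable_const)
  have hI : Measurable ((Set.Icc (-(2 * R)) (2 * R)).indicator (1 : ℝ → ℝ≥0∞)) :=
    measurable_one.indicator measurableSet_Icc
  have b0 := lintegral_halfPlane_le φ ψ 1 R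
  have b1 := lintegral_halfPlane_le (chirpFourier (-chirpRate) φ) (chirpFourier (-chirpRate) ψ)
    (Real.pi * Real.sqrt 3) R
  have b2 := lintegral_halfPlane_le (chirpFourier chirpRate φ) (chirpFourier chirpRate ψ)
    (-(Real.pi * Real.sqrt 3)) R
  have e0 := enorm_sub_sq_eq isDiagonalization_coordinate_zero.functionOf_theta ψ
  rw [LinearIsometryEquiv.coe_refl, id] at e0
  rw [e0] at b0
  rw [enorm_sub_sq_eq isDiagonalization_coordinate_two_pi_div_three.functionOf_theta ψ,
    LinearIsometryEquiv.enorm_map, LinearIsometryEquiv.enorm_map,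
    ← lintegral_chart (-chirpRate) φ ψ (hA _)] at b1
  rw [enorm_sub_sq_eq isDiagonalization_coordinate_four_pi_div_three.functionOf_theta ψ,
    LinearIsometryEquiv.enorm_map, LinearIsometryEquiv.enorm_map,
    ← lintegral_chart chirpRate φ ψ (hA _)] at b2
  refine le_trans ?_ (add_le_add (add_le_add (add_le_add b0 b1) b2) le_rfl)
  clear b0 b1 b2 e0
  rw [← lintegral_ambiguity φ ψ, ← lintegral_indicator_one_mul measurableSet_Icc]
  simp_rw [← lintegral_indicator_one_mul (s := Set.Icc (-(2 * R)) (2 * R)) measurableSet_Icc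
    (fun b => ‖⟪reflection _ b φ, ψ⟫_ℂ‖ₑ ^ 2)]
  refine lintegral_lintegral_le_of_cover (N := fun q b => ‖⟪reflection q b φ, ψ⟫_ℂ‖ₑ ^ 2)
    (measurable_ambiguity φ ψ) (hA _) (hA _) (hA _) hI _ _ fun q b => ?_
  by_cases hq : 1 * q < -R
  · rw [Set.indicator_of_mem (s := {x | 1 * x < -R}) (by exact hq), add_assoc, add_assoc]
    exact le_self_add
  by_cases h1 : Real.pi * Real.sqrt 3 * (b + -chirpRate * q) < -R
  · rw [Set.indicator_of_mem (s := {x | Real.pi * Real.sqrt 3 * x < -R}) (by exact h1), add_assoc]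
    exact le_add_self.trans le_self_add
  by_cases h2 : -(Real.pi * Real.sqrt 3) * (b + chirpRate * q) < -R
  · rw [Set.indicator_of_mem (s := {x | -(Real.pi * Real.sqrt 3) * x < -R}) (by exact h2)]
    exact le_add_self.trans le_self_add
  obtain ⟨h3, h4⟩ := plane_subset R q b hq h1 h2
  rw [Set.indicator_of_mem h3, Set.indicator_of_mem h4, Pi.one_apply, Pi.one_apply, one_mul]
  exact le_add_self

theorem exists_norm_eq_one : ∃ φ : StateSpace, ‖φ‖ = 1 := by
  refine ⟨indicatorConstLp 2 (measurableSet_Icc (a := (0 : ℝ)) (b := 1)) (by simp) 1, ?_⟩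
  rw [norm_indicatorConstLp (by simp) (by simp)]
  simp

/-- Outside a finite-dimensional obstruction, the three events cannot be almost certain at once. -/
theorem coercivity : ∃ (C : ℝ) (t : Finset StateSpace), 0 ≤ C ∧ ∀ ψ : StateSpace,
    ‖ψ‖ ^ 2 ≤ 2 * (‖ψ - projPos 0 ψ‖ ^ 2 + ‖ψ - projPos (2 * Real.pi / 3) ψ‖ ^ 2 +
      ‖ψ - projPos (4 * Real.pi / 3) ψ‖ ^ 2) + C * ∑ y ∈ t, ‖⟪y, ψ⟫_ℂ‖ ^ 2 := by
  obtain ⟨φ, hφ⟩ := exists_norm_eq_one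
  have hφe : ‖φ‖ₑ = 1 := by rw [← ofReal_norm, hφ, ENNReal.ofReal_one]
  -- Three tails and the compact error take `1/8` each; their total `‖ψ‖² / 2` is absorbed on the
  -- left, whence the factor `2`.
  have hpos : (0 : ℝ≥0∞) < ENNReal.ofReal (1 / 8) := by simp
  have t0 := (tendsto_tail φ 1).eventually_le_const hpos
  have t1 := (tendsto_tail (chirpFourier (-chirpRate) φ)
    (Real.pi * Real.sqrt 3)).eventually_le_const hpos
  have t2 := (tendsto_tail (chirpFourier chirpRate φ)
    (-(Real.pi * Real.sqrt 3))).eventually_le_const hpos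
  obtain ⟨n, h0, h1, h2⟩ := (t0.and (t1.and t2)).exists
  obtain ⟨C, t, hC, ht⟩ := lintegral_compact_le φ (2 * (n : ℝ)) (1 / 8) (by norm_num)
  refine ⟨2 * C, t, by positivity, fun ψ => ?_⟩
  have key := phaseSpace_inequality φ ψ n
  have hS : 0 ≤ ∑ y ∈ t, ‖⟪y, ψ⟫_ℂ‖ ^ 2 := by positivity
  rw [hφe, one_pow, one_mul, one_mul, one_mul, one_mul] at key
  have key2 := key.trans (add_le_add (add_le_add (add_le_add
    (add_le_add (mul_le_mul_left h0 (‖ψ‖ₑ ^ 2)) le_rfl)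
    (add_le_add (mul_le_mul_left h1 (‖ψ‖ₑ ^ 2)) le_rfl))
    (add_le_add (mul_le_mul_left h2 (‖ψ‖ₑ ^ 2)) le_rfl)) (ht ψ))
  have hn : ∀ x : StateSpace, ‖x‖ₑ ^ 2 = ENNReal.ofReal (‖x‖ ^ 2) := fun x => by
    rw [← ofReal_norm, ENNReal.ofReal_pow (norm_nonneg _)]
  simp only [hn] at key2
  rw [← ENNReal.ofReal_mul (by norm_num), ← ENNReal.ofReal_add (by positivity) (by positivity),
    ← ENNReal.ofReal_add (by positivity) (by positivity),
    ← ENNReal.ofReal_add (by positivity) (by positivity),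
    ← ENNReal.ofReal_add (by positivity) (by positivity),
    ← ENNReal.ofReal_add (by positivity) (by positivity),
    ← ENNReal.ofReal_add (by positivity) (by positivity),
    ENNReal.ofReal_le_ofReal_iff (by positivity)] at key2
  linarith

end Coercivity

/-! ### No vector is positive with certainty at two of the times. -/

section HalfLines

/-- Bounded support makes the exponential bounded locally uniformly in `z`, which allows
differentiation under the integral: the transform extends to an entire function. -/
theorem differentiable_fourierLaplace {k : ℝ → ℂ} (hk : Integrable k) {A : ℝ}
    (hA : ∀ᵐ x, A < |x| → k x = 0) :
    Differentiable ℂ fun z : ℂ =>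
      ∫ x : ℝ, Complex.exp (-(2 * Real.pi * Complex.I * x) * z) * k x := by
  intro z₀
  have hcont : ∀ z : ℂ, AEStronglyMeasurable
      (fun x : ℝ => Complex.exp (-(2 * Real.pi * Complex.I * x) * z) * k x) := fun z =>
    (Continuous.aestronglyMeasurable (by fun_prop)).mul hk.aestronglyMeasurable
  have hexp : ∀ z ∈ Metric.ball z₀ 1, ∀ x : ℝ, |x| ≤ A →
      ‖Complex.exp (-(2 * Real.pi * Complex.I * x) * z)‖ ≤
        Real.exp (2 * Real.pi * A * (‖z₀‖ + 1)) := by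
    intro z hz x hx
    refine (Complex.norm_exp_le_exp_norm _).trans (Real.exp_le_exp.2 ?_)
    rw [norm_mul, norm_neg, norm_mul, norm_mul, norm_mul, Complex.norm_I, Complex.norm_real,
      Complex.norm_real, Real.norm_of_nonneg Real.pi_pos.le]
    have hz' : ‖z‖ ≤ ‖z₀‖ + 1 := by
      have h1 : ‖z - z₀‖ < 1 := by simpa [dist_eq_norm] using hz
      have h2 := norm_sub_norm_le z z₀
      linarith
    simp only [Complex.norm_ofNat, mul_one, Real.norm_eq_abs]
    have := Real.pi_pos
    have hA0 : 0 ≤ A := (abs_nonneg x).trans hx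
    gcongr
  have h := hasDerivAt_integral_of_dominated_loc_of_deriv_le (μ := (volume : Measure ℝ))
    (F := fun (z : ℂ) (x : ℝ) => Complex.exp (-(2 * Real.pi * Complex.I * x) * z) * k x)
    (F' := fun (z : ℂ) (x : ℝ) =>
      Complex.exp (-(2 * Real.pi * Complex.I * x) * z) * (-(2 * Real.pi * Complex.I * x)) * k x)
    (bound := fun x => Real.exp (2 * Real.pi * A * (‖z₀‖ + 1)) * (2 * Real.pi * A) * ‖k x‖)
    (x₀ := z₀) (Metric.ball_mem_nhds z₀ one_pos) (Eventually.of_forall hcont) ?_ ?_ ?_ ?_ ?_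
  · exact h.2.differentiableAt
  · refine (hk.norm.const_mul (Real.exp (2 * Real.pi * A * (‖z₀‖ + 1)))).mono' (hcont z₀) ?_
    filter_upwards [hA] with x hx
    by_cases h0 : A < |x|
    · simp [hx h0]
    · rw [norm_mul]
      gcongr
      exact hexp z₀ (Metric.mem_ball_self one_pos) x (not_lt.1 h0)
  · exact (Continuous.aestronglyMeasurable (by fun_prop)).mul hk.aestronglyMeasurable
  · filter_upwards [hA] with x hx z hz
    by_cases h0 : A < |x|
    · simp [hx h0]
    · rw [not_lt] at h0
      rw [norm_mul, norm_mul]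
      have hx2 : ‖(-(2 * Real.pi * Complex.I * x) : ℂ)‖ ≤ 2 * Real.pi * A := by
        rw [norm_neg, norm_mul, norm_mul, norm_mul, Complex.norm_I, Complex.norm_real,
          Complex.norm_real, Real.norm_of_nonneg Real.pi_pos.le]
        simp only [Complex.norm_ofNat, mul_one, Real.norm_eq_abs]
        have := Real.pi_pos
        gcongr
      gcongr
      exact hexp z hz x h0
  · exact hk.norm.const_mul _
  · refine Eventually.of_forall fun x z _ => ?_
    have h1 : HasDerivAt (fun z : ℂ => -(2 * Real.pi * Complex.I * x) * z)
        (-(2 * Real.pi * Complex.I * x)) z := by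
      simpa using (hasDerivAt_id z).const_mul (-(2 * Real.pi * Complex.I * x : ℂ))
    exact h1.cexp.mul_const (k x)

theorem fourier_eq_zero_of_eqOn_Iic {k : ℝ → ℂ} (hk : Integrable k) {A : ℝ}
    (hA : ∀ᵐ x, A < |x| → k x = 0) (h0 : ∀ b ≤ 0, 𝓕 k b = 0) : 𝓕 k = 0 := by
  set Φ : ℂ → ℂ := fun z => ∫ x : ℝ, Complex.exp (-(2 * Real.pi * Complex.I * x) * z) * k x
  have hΦ : Differentiable ℂ Φ := differentiable_fourierLaplace hk hA
  have e : ∀ b : ℝ, 𝓕 k b = Φ b := fun b => by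
    rw [fourier_eq_phase]
    refine integral_congr_ae (Eventually.of_forall fun x => ?_)
    simp only [phase_eq]
    congr 2
    push_cast
    ring
  have hfreq : ∃ᶠ z in 𝓝[≠] (-1 : ℂ), Φ z = 0 := by
    have ht : Tendsto (fun b : ℝ => (b : ℂ)) (𝓝[<] (-1)) (𝓝[≠] (-1 : ℂ)) := by
      refine tendsto_nhdsWithin_iff.2 ⟨?_, ?_⟩
      · have := Complex.continuous_ofReal.tendsto (-1)
        simp only [Complex.ofReal_neg, Complex.ofReal_one] at this
        exact this.mono_left nhdsWithin_le_nhds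
      · filter_upwards [self_mem_nhdsWithin] with b hb
        intro h
        have : b = -1 := by
          rw [Set.mem_singleton_iff] at h
          exact_mod_cast h
        exact (ne_of_lt hb) this
    refine ht.frequently (Eventually.frequently ?_)
    filter_upwards [self_mem_nhdsWithin] with b hb
    rw [← e]
    exact h0 b (le_of_lt (lt_trans hb (by norm_num)))
  have hz := (hΦ.differentiableOn (s := Set.univ)).analyticOnNhd isOpen_univ
    |>.eqOn_zero_of_preconnected_of_frequently_eq_zero isPreconnected_univ (Set.mem_univ _) hfreq
  ext b
  rw [e]
  exact hz (Set.mem_univ _)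

/-- A square integrable function vanishes if it and its Fourier transform are both supported on the
positive half-line. -/
theorem eq_zero_of_halfLine_support {f : StateSpace} (h1 : ∀ᵐ x, x ≤ 0 → f x = 0)
    (h2 : ∀ᵐ x, x ≤ 0 → fourierL2 f x = 0) : f = 0 := by
  -- The product is supported in `[0, a]`, so its transform is entire. At `b ≤ 0` that transform
  -- pairs `fourierL2 f` with its reflection about `b / 2`, whose support is disjoint; so it
  -- vanishes on a half-line, hence identically.
  have hk : ∀ a, (fun x => conj (f (a - x)) * f x) =ᵐ[volume] 0 := by
    intro a
    have hint := integrable_conj_mul a f f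
    have h1' := (Measure.measurePreserving_sub_left
      (volume : Measure ℝ) a).quasiMeasurePreserving.ae h1
    refine ae_eq_zero_of_fourier_eq_zero hint (fourier_eq_zero_of_eqOn_Iic hint (A := |a|) ?_ ?_)
    · filter_upwards [h1, h1'] with x hx hx' hax
      rcases le_or_gt x 0 with h | h
      · rw [hx h, mul_zero]
      · rw [abs_of_pos h] at hax
        rw [hx' (by linarith [le_abs_self a]), map_zero, zero_mul]
    · intro b hb
      rw [← inner_reflection, ← fourierL2.inner_map_map, fourierL2_reflection, inner_smul_left,
        L2.inner_def]
      rw [integral_eq_zero_of_ae, mul_zero]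
      have h2' := (Measure.measurePreserving_sub_left
        (volume : Measure ℝ) b).quasiMeasurePreserving.ae h2
      filter_upwards [coeFn_reflection b (-a) (fourierL2 f), h2, h2'] with x hx hx2 hx3
      rw [hx]
      rcases le_or_gt x 0 with h | h
      · rw [hx2 h]
        simp
      · rw [hx3 (by linarith)]
        simp
  have hm : Measurable fun x => ‖f x‖ₑ := (Lp.stronglyMeasurable f).measurable.enorm
  have htot := lintegral_lintegral_convolution hm hm
  -- Integrating over `a` gives `(∫ |f|)² = 0`; integrability of `f` is not needed in `ℝ≥0∞`.
  have hz : ∫⁻ s, ∫⁻ ξ, ‖f (s - ξ)‖ₑ * ‖f ξ‖ₑ = 0 := by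
    rw [← lintegral_zero (μ := (volume : Measure ℝ))]
    refine lintegral_congr fun s => ?_
    rw [← lintegral_zero (μ := (volume : Measure ℝ))]
    apply lintegral_congr_ae
    filter_upwards [hk s] with x hx
    rw [← RCLike.enorm_conj, ← enorm_mul, hx]
    simp
  rw [hz, eq_comm, mul_self_eq_zero, lintegral_eq_zero_iff hm] at htot
  rw [Lp.eq_zero_iff_ae_eq_zero]
  filter_upwards [htot] with x hx
  simpa using hx

theorem ae_eq_zero_of_sub_eq_zero {κ : ℝ} {U : StateSpace ≃ₗᵢ[ℂ] StateSpace}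
    {E : StateSpace →L[ℂ] StateSpace} (h : Diagonalizes U (fun x => theta (κ * x)) E)
    {ψ : StateSpace} (hψ : ψ - E ψ = 0) : ∀ᵐ x, κ * x ≤ 0 → U ψ x = 0 := by
  filter_upwards [h ψ] with x hx hle
  rw [sub_eq_zero] at hψ
  rw [hψ, hx, theta, if_neg (not_lt.2 hle)]
  simp

/-- A chirp does not change supports, so the event at time `0` says that the chirped vector lives on
the half-line, and the event at `2π/3` says the same of its Fourier transform. -/
theorem eq_zero_of_projPos_eq_self {ψ : StateSpace} (h0 : ψ - projPos 0 ψ = 0)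
    (h1 : ψ - projPos (2 * Real.pi / 3) ψ = 0) : ψ = 0 := by
  have a0 := ae_eq_zero_of_sub_eq_zero isDiagonalization_coordinate_zero.functionOf_theta h0
  have a1 := ae_eq_zero_of_sub_eq_zero
    isDiagonalization_coordinate_two_pi_div_three.functionOf_theta h1
  have : chirp (-chirpRate) ψ = 0 := by
    refine eq_zero_of_halfLine_support ?_ ?_
    · filter_upwards [a0, coeFn_chirp (-chirpRate) ψ] with x hx hc hle
      rw [hc]
      rw [LinearIsometryEquiv.coe_refl, id] at hx
      rw [hx (by linarith), mul_zero]
    · filter_upwards [a1] with x hx hle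
      exact hx (mul_nonpos_of_nonneg_of_nonpos (by positivity) hle)
  exact (LinearIsometryEquiv.map_eq_zero_iff _).1 this

end HalfLines

/-! ### Compactness and the spectral gap. -/

section Gap

/-- The total weight of the complementary events. -/
def deficit (ψ : StateSpace) : ℝ :=
  ‖ψ - projPos 0 ψ‖ ^ 2 + ‖ψ - projPos (2 * Real.pi / 3) ψ‖ ^ 2 +
    ‖ψ - projPos (4 * Real.pi / 3) ψ‖ ^ 2

theorem deficit_nonneg (ψ : StateSpace) : 0 ≤ deficit ψ := by
  unfold deficit
  positivity

theorem continuous_deficit : Continuous deficit := by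
  unfold deficit
  fun_prop

theorem deficit_sub_le (φ ψ : StateSpace) :
    deficit (φ - ψ) ≤ 2 * deficit φ + 2 * deficit ψ := by
  have h : ∀ E : StateSpace →L[ℂ] StateSpace, ‖φ - ψ - E (φ - ψ)‖ ^ 2 ≤
      2 * ‖φ - E φ‖ ^ 2 + 2 * ‖ψ - E ψ‖ ^ 2 := fun E => by
    have e : φ - ψ - E (φ - ψ) = (φ - E φ) - (ψ - E ψ) := by
      rw [map_sub]
      abel
    rw [e]
    have := norm_sub_le (φ - E φ) (ψ - E ψ)
    have h2 : ‖(φ - E φ) - (ψ - E ψ)‖ ^ 2 ≤ (‖φ - E φ‖ + ‖ψ - E ψ‖) ^ 2 := by gcongr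
    nlinarith [sq_nonneg (‖φ - E φ‖ - ‖ψ - E ψ‖)]
  have h0 := h (projPos 0)
  have h1 := h (projPos (2 * Real.pi / 3))
  have h2 := h (projPos (4 * Real.pi / 3))
  unfold deficit
  linarith

theorem eq_zero_of_deficit_eq_zero {ψ : StateSpace} (h : deficit ψ = 0) : ψ = 0 := by
  have a := sq_nonneg ‖ψ - projPos 0 ψ‖
  have b := sq_nonneg ‖ψ - projPos (2 * Real.pi / 3) ψ‖
  have c := sq_nonneg ‖ψ - projPos (4 * Real.pi / 3) ψ‖
  unfold deficit at h
  refine eq_zero_of_projPos_eq_self ?_ ?_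
  · rw [← norm_eq_zero, ← sq_eq_zero_iff]
    linarith
  · rw [← norm_eq_zero, ← sq_eq_zero_iff]
    linarith

/-- Otherwise take unit vectors with deficit tending to zero. Along a subsequence the finitely many
functionals of `coercivity` converge; coercivity applied to differences makes it Cauchy, and its
limit is a unit vector of zero deficit. -/
theorem exists_deficit_gap : ∃ δ : ℝ, 0 < δ ∧ ∀ ψ : StateSpace, ‖ψ‖ = 1 → δ ≤ deficit ψ := by
  obtain ⟨C, t, hC, hco⟩ := coercivity
  by_contra! hcon
  have hex : ∀ n : ℕ, ∃ ψ : StateSpace, ‖ψ‖ = 1 ∧ deficit ψ < 1 / ((n : ℝ) + 1) := fun n =>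
    hcon _ (by positivity)
  choose u hu1 hu2 using hex
  have hd : Tendsto (fun n => deficit (u n)) atTop (𝓝 0) :=
    squeeze_zero (fun n => deficit_nonneg _) (fun n => (hu2 n).le)
      tendsto_one_div_add_atTop_nhds_zero_nat
  let v : ℕ → t → ℂ := fun n y => ⟪(y : StateSpace), u n⟫_ℂ
  have hv : ∀ n, v n ∈ Metric.closedBall (0 : t → ℂ) (∑ y ∈ t, ‖y‖) := fun n => by
    rw [mem_closedBall_zero_iff, pi_norm_le_iff_of_nonneg (by positivity)]
    intro y
    refine (norm_inner_le_norm _ _).trans ?_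
    rw [hu1, mul_one]
    exact Finset.single_le_sum (f := fun y : StateSpace => ‖y‖) (fun _ _ => norm_nonneg _) y.2
  obtain ⟨w, -, σ, hσ, hw⟩ := tendsto_subseq_of_bounded Metric.isBounded_closedBall hv
  have hdσ : Tendsto (fun n => deficit (u (σ n))) atTop (𝓝 0) := hd.comp hσ.tendsto_atTop
  have hvd : Tendsto (fun p : ℕ × ℕ => dist (v (σ p.1)) (v (σ p.2))) atTop (𝓝 0) :=
    cauchySeq_iff_tendsto_dist_atTop_0.1 hw.cauchySeq
  have hbound : ∀ p : ℕ × ℕ, ‖u (σ p.1) - u (σ p.2)‖ ^ 2 ≤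
      2 * (2 * deficit (u (σ p.1)) + 2 * deficit (u (σ p.2))) +
        C * (t.card * dist (v (σ p.1)) (v (σ p.2)) ^ 2) := by
    intro p
    have hs : ∑ y ∈ t, ‖⟪y, u (σ p.1) - u (σ p.2)⟫_ℂ‖ ^ 2 ≤
        t.card * dist (v (σ p.1)) (v (σ p.2)) ^ 2 := by
      rw [← nsmul_eq_mul]
      refine Finset.sum_le_card_nsmul _ _ _ fun y hy => ?_
      rw [inner_sub_right, ← dist_eq_norm]
      gcongr
      exact dist_le_pi_dist (v (σ p.1)) (v (σ p.2)) ⟨y, hy⟩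
    exact (hco _).trans (add_le_add (mul_le_mul_of_nonneg_left (deficit_sub_le _ _) zero_le_two)
      (mul_le_mul_of_nonneg_left hs hC))
  have hlim : Tendsto (fun p : ℕ × ℕ => 2 * (2 * deficit (u (σ p.1)) + 2 * deficit (u (σ p.2))) +
      C * (t.card * dist (v (σ p.1)) (v (σ p.2)) ^ 2)) atTop (𝓝 0) := by
    have l1 : Tendsto (fun p : ℕ × ℕ => deficit (u (σ p.1))) atTop (𝓝 0) :=
      hdσ.comp (by rw [← prod_atTop_atTop_eq]; exact tendsto_fst)
    have l2 : Tendsto (fun p : ℕ × ℕ => deficit (u (σ p.2))) atTop (𝓝 0) :=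
      hdσ.comp (by rw [← prod_atTop_atTop_eq]; exact tendsto_snd)
    have := (((l1.const_mul 2).add (l2.const_mul 2)).const_mul 2).add
      (((hvd.pow 2).const_mul (t.card : ℝ)).const_mul C)
    simpa using this
  have hcauchy : CauchySeq (u ∘ σ) := by
    rw [cauchySeq_iff_tendsto_dist_atTop_0]
    have h3 := (Real.continuous_sqrt.tendsto 0).comp hlim
    rw [Real.sqrt_zero] at h3
    refine squeeze_zero (fun _ => dist_nonneg) (fun p => ?_) h3
    rw [dist_eq_norm]
    exact Real.le_sqrt_of_sq_le (hbound p)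
  obtain ⟨ψ, hψ⟩ := cauchySeq_tendsto_of_complete hcauchy
  have hn : ‖ψ‖ = 1 := by
    refine tendsto_nhds_unique hψ.norm ?_
    simp [hu1]
  have h0 : deficit ψ = 0 :=
    tendsto_nhds_unique ((continuous_deficit.tendsto ψ).comp hψ) hdσ
  rw [eq_zero_of_deficit_eq_zero h0, norm_zero] at hn
  exact zero_ne_one hn

end Gap

/-! ### Parity, the norm of `A` and the spectrum of `M`. -/

section Spectral

/-- The identity `θ = (1 + sgn)/2` fails only at `0`, a null set because `κ ≠ 0`. -/
theorem Diagonalizes.theta_eq_sign {κ : ℝ} (hκ : κ ≠ 0) {U : StateSpace ≃ₗᵢ[ℂ] StateSpace}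
    {S E : StateSpace →L[ℂ] StateSpace} (hS : Diagonalizes U (fun x => Real.sign (κ * x)) S)
    (hE : Diagonalizes U (fun x => theta (κ * x)) E) :
    E = (1 / 2 : ℂ) • 1 + (1 / 2 : ℂ) • S := by
  have h : Diagonalizes U (fun x => theta (κ * x))
      (((1 / 2 : ℝ) : ℂ) • 1 + ((1 / 2 : ℝ) : ℂ) • S) := by
    refine ((Diagonalizes.one.smul (1 / 2)).add (hS.smul (1 / 2))).congr ?_
    have hne : ∀ᵐ x : ℝ, x ≠ 0 := by
      rw [ae_iff]
      simp
    filter_upwards [hne] with x hx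
    rcases lt_or_gt_of_ne (mul_ne_zero hκ hx) with h | h
    · rw [Real.sign_of_neg h, theta, if_neg h.not_gt]
      norm_num
    · rw [Real.sign_of_pos h, theta, if_pos h]
      norm_num
  rw [hE.unique h]
  push_cast
  rfl

theorem Diagonalizes.norm_sub_sq {H : Type*} [NormedAddCommGroup H] [InnerProductSpace ℂ H]
    {X : Type*} [MeasurableSpace X] {μ : Measure X} {U : H ≃ₗᵢ[ℂ] Lp ℂ 2 μ} {g : X → ℝ}
    {E : H →L[ℂ] H} (h : Diagonalizes U (fun x => theta (g x)) E) (ψ : H) :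
    ‖ψ - E ψ‖ ^ 2 = ‖ψ‖ ^ 2 - (⟪ψ, E ψ⟫_ℂ).re := by
  have hE : E * E = E := (h.comp h).unique (h.congr (Eventually.of_forall fun x => by
    simp only [theta]
    split_ifs <;> simp))
  have hE' : ⟪E ψ, E ψ⟫_ℂ = ⟪ψ, E ψ⟫_ℂ := by
    rw [h.inner_comm, ← mul_apply_eq_comp, hE]
  rw [@_root_.norm_sub_sq ℂ, ← @inner_self_eq_norm_sq ℂ H _ _ _ (E ψ), hE']
  simp only [RCLike.re_to_complex]
  ring

theorem pi_mul_sqrt_three_ne_zero : Real.pi * Real.sqrt 3 ≠ 0 := by positivity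

theorem projPos_zero : projPos 0 = (1 / 2 : ℂ) • 1 + (1 / 2 : ℂ) • sgnQ 0 :=
  Diagonalizes.theta_eq_sign one_ne_zero isDiagonalization_coordinate_zero.functionOf_sign
    isDiagonalization_coordinate_zero.functionOf_theta

theorem projPos_two_pi_div_three : projPos (2 * Real.pi / 3) =
    (1 / 2 : ℂ) • 1 + (1 / 2 : ℂ) • sgnQ (2 * Real.pi / 3) :=
  Diagonalizes.theta_eq_sign pi_mul_sqrt_three_ne_zero
    isDiagonalization_coordinate_two_pi_div_three.functionOf_sign
    isDiagonalization_coordinate_two_pi_div_three.functionOf_theta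

theorem projPos_four_pi_div_three : projPos (4 * Real.pi / 3) =
    (1 / 2 : ℂ) • 1 + (1 / 2 : ℂ) • sgnQ (4 * Real.pi / 3) :=
  Diagonalizes.theta_eq_sign (neg_ne_zero.2 pi_mul_sqrt_three_ne_zero)
    isDiagonalization_coordinate_four_pi_div_three.functionOf_sign
    isDiagonalization_coordinate_four_pi_div_three.functionOf_theta

theorem opE_eq : opE = (1 / 2 : ℂ) • 1 + (1 / 6 : ℂ) • opA := by
  rw [opE, opA, projPos_zero, projPos_two_pi_div_three, projPos_four_pi_div_three]
  module

theorem isSelfAdjoint_opA : IsSelfAdjoint opA :=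
  (isDiagonalization_coordinate_zero.functionOf_sign.isSelfAdjoint.add
    isDiagonalization_coordinate_two_pi_div_three.functionOf_sign.isSelfAdjoint).add
    isDiagonalization_coordinate_four_pi_div_three.functionOf_sign.isSelfAdjoint

theorem isSelfAdjoint_opE : IsSelfAdjoint opE := by
  rw [opE_eq]
  refine IsSelfAdjoint.add (IsSelfAdjoint.smul ?_ (IsSelfAdjoint.one _))
    (IsSelfAdjoint.smul ?_ isSelfAdjoint_opA) <;> simp [isSelfAdjoint_iff]

/-- `reflection 0 0` is the parity operator, and the sign is odd. -/
theorem sign_reflection {κ : ℝ} {U : StateSpace ≃ₗᵢ[ℂ] StateSpace}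
    {S : StateSpace →L[ℂ] StateSpace} (hS : Diagonalizes U (fun x => Real.sign (κ * x)) S)
    (hU : ∀ ψ, U (reflection 0 0 ψ) = reflection 0 0 (U ψ)) (ψ : StateSpace) :
    S (reflection 0 0 ψ) = -reflection 0 0 (S ψ) := by
  apply U.injective
  rw [map_neg, hU]
  apply Lp.ext
  filter_upwards [hS (reflection 0 0 ψ), Lp.coeFn_neg (reflection 0 0 (U (S ψ))),
    coeFn_reflection 0 0 (U (S ψ)), coeFn_reflection 0 0 (U ψ),
    (Measure.measurePreserving_sub_left volume (0 : ℝ)).quasiMeasurePreserving.ae (hS ψ)]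
    with x h1 h2 h3 h4 h5
  rw [h1, h2, Pi.neg_apply, h3, hU, h4, h5, zero_sub, mul_neg, Real.sign_neg]
  push_cast
  ring

theorem chirpFourier_parity (c : ℝ) (ψ : StateSpace) :
    chirpFourier c (reflection 0 0 ψ) = reflection 0 0 (chirpFourier c ψ) := by
  rw [chirpFourier_reflection]
  simp [phase_zero]

theorem opA_parity (ψ : StateSpace) : opA (reflection 0 0 ψ) = -reflection 0 0 (opA ψ) := by
  have h0 : sgnQ 0 (reflection 0 0 ψ) = -reflection 0 0 (sgnQ 0 ψ) :=
    sign_reflection isDiagonalization_coordinate_zero.functionOf_sign (fun _ => rfl) ψ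
  have h1 : sgnQ (2 * Real.pi / 3) (reflection 0 0 ψ) =
      -reflection 0 0 (sgnQ (2 * Real.pi / 3) ψ) :=
    sign_reflection isDiagonalization_coordinate_two_pi_div_three.functionOf_sign
      (chirpFourier_parity _) ψ
  have h2 : sgnQ (4 * Real.pi / 3) (reflection 0 0 ψ) =
      -reflection 0 0 (sgnQ (4 * Real.pi / 3) ψ) :=
    sign_reflection isDiagonalization_coordinate_four_pi_div_three.functionOf_sign
      (chirpFourier_parity _) ψ
  simp only [opA, add_apply, h0, h1, h2, map_add]
  abel

theorem re_inner_opA_parity (ψ : StateSpace) :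
    (⟪reflection 0 0 ψ, opA (reflection 0 0 ψ)⟫_ℂ).re = -(⟪ψ, opA ψ⟫_ℂ).re := by
  rw [opA_parity, inner_neg_right, LinearIsometry.inner_map_map, Complex.neg_re]

theorem prob_eq {ψ : StateSpace} (hψ : ‖ψ‖ = 1) :
    prob ψ = 1 / 2 + (⟪ψ, opA ψ⟫_ℂ).re / 6 := by
  have h1 : ⟪ψ, ψ⟫_ℂ = 1 := by
    rw [inner_self_eq_norm_sq_to_K, hψ]
    simp
  rw [prob, opE_eq, add_apply, smul_apply, smul_apply, one_apply_eq_self, inner_add_right,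
    inner_smul_right, inner_smul_right, h1]
  simp [Complex.mul_re]
  norm_num
  ring

theorem prob_eq_deficit {ψ : StateSpace} (hψ : ‖ψ‖ = 1) : prob ψ = 1 - deficit ψ / 3 := by
  have h0 : ‖ψ - projPos 0 ψ‖ ^ 2 = _ :=
    isDiagonalization_coordinate_zero.functionOf_theta.norm_sub_sq ψ
  have h1 : ‖ψ - projPos (2 * Real.pi / 3) ψ‖ ^ 2 = _ :=
    isDiagonalization_coordinate_two_pi_div_three.functionOf_theta.norm_sub_sq ψ
  have h2 : ‖ψ - projPos (4 * Real.pi / 3) ψ‖ ^ 2 = _ :=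
    isDiagonalization_coordinate_four_pi_div_three.functionOf_theta.norm_sub_sq ψ
  rw [deficit, h0, h1, h2, hψ, prob, opE, smul_apply, add_apply, add_apply, inner_smul_right,
    inner_add_right, inner_add_right, show (1 / 3 : ℂ) = ((1 / 3 : ℝ) : ℂ) by push_cast; rfl,
    Complex.re_ofReal_mul, Complex.add_re, Complex.add_re]
  simp only [projPos]
  ring

/-- Parity negates the quadratic form, so a one-sided bound is two-sided; for a self-adjoint
operator this bounds the norm. -/
theorem norm_opA_le {M : ℝ} (h : ∀ ψ : StateSpace, ‖ψ‖ = 1 → (⟪ψ, opA ψ⟫_ℂ).re ≤ M) :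
    ‖opA‖ ≤ M := by
  have habs : ∀ ψ : StateSpace, ‖ψ‖ = 1 → |(⟪ψ, opA ψ⟫_ℂ).re| ≤ M := fun ψ hψ => by
    have h1 := h (reflection 0 0 ψ) (by rw [LinearIsometry.norm_map, hψ])
    rw [re_inner_opA_parity] at h1
    exact abs_le.2 ⟨by linarith, h ψ hψ⟩
  have hM : 0 ≤ M := by
    obtain ⟨φ, hφ⟩ := exists_norm_eq_one
    exact (abs_nonneg _).trans (habs φ hφ)
  rw [ContinuousLinearMap.norm_eq_iSup_rayleighQuotient opA isSelfAdjoint_opA.isSymmetric]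
  refine ciSup_le fun x => ?_
  by_cases hx : x = 0
  · simpa [hx] using hM
  have hx' : ‖x‖ ≠ 0 := norm_ne_zero_iff.2 hx
  have hc : ((‖x‖⁻¹ : ℝ) : ℂ) ≠ 0 := by exact_mod_cast inv_ne_zero hx'
  rw [← ContinuousLinearMap.rayleigh_smul opA x hc]
  have hu : ‖((‖x‖⁻¹ : ℝ) : ℂ) • x‖ = 1 := by
    rw [norm_smul, Complex.norm_real, norm_inv, norm_norm, inv_mul_cancel₀ hx']
  rw [ContinuousLinearMap.rayleighQuotient, ContinuousLinearMap.reApplyInnerSelf_apply, hu,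
    one_pow, div_one, inner_re_symm]
  exact habs _ hu

theorem re_inner_opA_le {ψ : StateSpace} (hψ : ‖ψ‖ = 1) : |(⟪ψ, opA ψ⟫_ℂ).re| ≤ ‖opA‖ := by
  refine (Complex.abs_re_le_norm _).trans ((norm_inner_le_norm _ _).trans ?_)
  rw [hψ, one_mul]
  exact (opA.le_opNorm ψ).trans (by rw [hψ, mul_one])

theorem norm_opA_lt : ‖opA‖ < 3 := by
  obtain ⟨δ, hδ, hgap⟩ := exists_deficit_gap
  have : ‖opA‖ ≤ 3 - 2 * δ := norm_opA_le fun ψ hψ => by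
    have h1 := prob_eq hψ
    have h2 := prob_eq_deficit hψ
    have h3 := hgap ψ hψ
    linarith
  linarith

instance : Nontrivial StateSpace := by
  obtain ⟨φ, hφ⟩ := exists_norm_eq_one
  exact ⟨φ, 0, fun h => by simp [h] at hφ⟩

/-- Were `‖A‖` in the resolvent set, the Rayleigh quotients would stay below `‖A‖ - ε`,
contradicting `norm_opA_le`. -/
theorem norm_mem_spectrum_opA : ((‖opA‖ : ℝ) : ℂ) ∈ spectrum ℂ opA := by
  by_contra hn
  have hres : algebraMap ℝ ℂ ‖opA‖ ∈ resolventSet ℂ opA := by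
    simpa [spectrum] using hn
  obtain ⟨ε, hε, h⟩ := opA.rayleighQuotient_le_of_norm_mem_resolventSet hres
  have : ‖opA‖ ≤ ‖opA‖ - ε := norm_opA_le fun ψ hψ => by
    have := h ψ
    rwa [ContinuousLinearMap.rayleighQuotient, ContinuousLinearMap.reApplyInnerSelf_apply, hψ,
      one_pow, div_one, inner_re_symm] at this
  linarith

theorem neg_norm_mem_spectrum_opA : ((-‖opA‖ : ℝ) : ℂ) ∈ spectrum ℂ opA := by
  by_contra hn
  have hres : algebraMap ℝ ℂ ‖-opA‖ ∈ resolventSet ℂ (-opA) := by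
    have h : -(((-‖opA‖ : ℝ) : ℂ)) ∉ spectrum ℂ (-opA) := by
      rw [← spectrum.neg_eq, Set.neg_mem_neg]
      exact hn
    simpa [spectrum] using h
  obtain ⟨ε, hε, h⟩ := (-opA).rayleighQuotient_le_of_norm_mem_resolventSet hres
  rw [norm_neg] at h
  have : ‖opA‖ ≤ ‖opA‖ - ε := norm_opA_le fun ψ hψ => by
    have := h (reflection 0 0 ψ)
    rw [ContinuousLinearMap.rayleighQuotient, ContinuousLinearMap.reApplyInnerSelf_apply,
      LinearIsometry.norm_map, hψ, one_pow, div_one, inner_re_symm, neg_apply, inner_neg_right,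
      map_neg] at this
    have e := re_inner_opA_parity ψ
    rw [RCLike.re_to_complex] at this
    linarith
  linarith

theorem mem_spectrum_opE_iff (r : ℝ) :
    r ∈ spectrum ℝ opE ↔ ((6 * r - 3 : ℝ) : ℂ) ∈ spectrum ℂ opA := by
  rw [← spectrum.algebraMap_mem_iff ℂ, spectrum.mem_iff, spectrum.mem_iff, not_iff_not]
  have e : algebraMap ℂ (StateSpace →L[ℂ] StateSpace) (algebraMap ℝ ℂ r) - opE =
      Units.mk0 (1 / 6 : ℂ) (by norm_num) •
        (algebraMap ℂ (StateSpace →L[ℂ] StateSpace) ((6 * r - 3 : ℝ) : ℂ) - opA) := by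
    rw [opE_eq, Units.smul_mk0, Complex.coe_algebraMap, Algebra.algebraMap_eq_smul_one,
      Algebra.algebraMap_eq_smul_one]
    push_cast
    module
  rw [e, isUnit_smul_iff]

theorem abs_le_of_mem_spectrum_opE {r : ℝ} (h : r ∈ spectrum ℝ opE) : |6 * r - 3| ≤ ‖opA‖ := by
  have := spectrum.norm_le_norm_of_mem ((mem_spectrum_opE_iff r).1 h)
  rwa [Complex.norm_real] at this

end Spectral
end Oscillator
end

theorem theorem1 :
    -- the operators `sgn Q(t)` and `E(t) = θ(Q(t))` are well defined
    (∀ t : ℝ, IsSelfAdjoint (Oscillator.coordinate t) ∧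
      (∃! S, Oscillator.IsFunctionOf Real.sign (Oscillator.coordinate t) S) ∧
      (∃! S, Oscillator.IsFunctionOf Oscillator.theta (Oscillator.coordinate t) S)) ∧
    -- the operator norm of `A` is strictly less than 3
    ‖Oscillator.opA‖ < 3 ∧
    -- the probability is bounded away from 1 over all states
    (∃ c : ℝ, c < 1 ∧ ∀ ψ : Oscillator.StateSpace, ‖ψ‖ = 1 → Oscillator.prob ψ ≤ c) ∧
    -- `(E(0) + E(2π/3) + E(4π/3)) / 3 = 1/2 + A/6`, a self-adjoint operator, and its spectral bounds
    Oscillator.opE = (1 / 2 : ℂ) • 1 + (1 / 6 : ℂ) • Oscillator.opA ∧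
    IsSelfAdjoint Oscillator.opE ∧
    IsLeast (spectrum ℝ Oscillator.opE) (1 / 2 - ‖Oscillator.opA‖ / 6) ∧
    IsGreatest (spectrum ℝ Oscillator.opE) (1 / 2 + ‖Oscillator.opA‖ / 6) ∧
    -- which are also the bounds of the probability over all states
    IsGLB {p : ℝ | ∃ ψ : Oscillator.StateSpace, ‖ψ‖ = 1 ∧ Oscillator.prob ψ = p}
      (1 / 2 - ‖Oscillator.opA‖ / 6) ∧
    IsLUB {p : ℝ | ∃ ψ : Oscillator.StateSpace, ‖ψ‖ = 1 ∧ Oscillator.prob ψ = p}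
      (1 / 2 + ‖Oscillator.opA‖ / 6) := by
  open Oscillator in
  refine ⟨fun t => ?_, norm_opA_lt, ?_, opE_eq, isSelfAdjoint_opE, ⟨?_, ?_⟩, ⟨?_, ?_⟩, ⟨?_, ?_⟩,
    ⟨?_, ?_⟩⟩
  · obtain ⟨U, g, h⟩ := exists_isDiagonalization_coordinate t
    exact ⟨h.isSelfAdjoint, h.existsUnique_sign, h.existsUnique_theta⟩
  · refine ⟨1 / 2 + ‖opA‖ / 6, by linarith [norm_opA_lt], fun ψ hψ => ?_⟩
    rw [prob_eq hψ]
    linarith [(abs_le.1 (re_inner_opA_le hψ)).2]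
  · rw [mem_spectrum_opE_iff]
    convert neg_norm_mem_spectrum_opA using 2
    ring
  · intro r hr
    linarith [(abs_le.1 (abs_le_of_mem_spectrum_opE hr)).1]
  · rw [mem_spectrum_opE_iff]
    convert norm_mem_spectrum_opA using 2
    ring
  · intro r hr
    linarith [(abs_le.1 (abs_le_of_mem_spectrum_opE hr)).2]
  · rintro _ ⟨ψ, hψ, rfl⟩
    rw [prob_eq hψ]
    linarith [(abs_le.1 (re_inner_opA_le hψ)).1]
  · intro b hb
    -- Parity sends `prob` to `1 - prob`, so a lower bound at the reflected state is an upper bound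
    -- at `ψ`.
    have : ‖opA‖ ≤ 3 - 6 * b := norm_opA_le fun ψ hψ => by
      have hψ' : ‖reflection 0 0 ψ‖ = 1 := by rw [LinearIsometry.norm_map, hψ]
      have h1 := hb ⟨reflection 0 0 ψ, hψ', rfl⟩
      rw [prob_eq hψ', re_inner_opA_parity] at h1
      linarith
    linarith
  · rintro _ ⟨ψ, hψ, rfl⟩
    rw [prob_eq hψ]
    linarith [(abs_le.1 (re_inner_opA_le hψ)).2]
  · intro b hb
    have : ‖opA‖ ≤ 6 * b - 3 := norm_opA_le fun ψ hψ => by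
      have h1 := hb ⟨ψ, hψ, rfl⟩
      rw [prob_eq hψ] at h1
      linarith
    linarith
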